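/- Let $p>2$ be a prime and let $K$ be a local field of characteristic $p$, that is, a field of characteristic $p$ that is complete with respect to a (normalized) discrete valuation and has perfect residue field. For a finite extension $L/K$ let $v_L$ be the valuation of $L$ extending that of $K$ and normalized by $v_L(L^\times)=\mathbb{Z}$, and let $\pi_L$ be a uniformizer of $L$. For a totally ramified Galois extension $L/K$ of degree $mp^n$, $p\nmid m$, with group $G$, set $i(\sigma)=v_L(\sigma(\pi_L)-\pi_L)-1$ for $\sigma\in G\smallsetminus\{1\}$, $i(1)=\infty$, and $G_x=\{\sigma\in G: i(\sigma)\ge x\}$. The lower ramification breaks are the numbers $i(\sigma)$, $\sigma\ne1$; a positive lower break $c$ is counted with multiplicity $d$, where $|G_c:G_{c+1}|=p^d$. Let $b_1\le\dots\le b_n$ be the positive lower breaks. The upper ramification breaks are the numbers $u_1\le\dots\le u_n$ with $u_1=b_1/m$ and $u_{j+1}-u_j=(b_{j+1}-b_j)/(mp^j)$ for $1\le j\le n-1$, together with $u_0=0$ in case $0$ is a lower break; $\mathcal U_{L/K}$ denotes the multiset of upper breaks. A ramified $C_p$-extension has exactly one lower break and one upper break, and they agree; this number is called its ramification break. Let $H(1,1)$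 be the Heisenberg group of order $p^3$, generated by $x,y,z$ of order $p$ with $z$ central and $[x,y]=z$. **Proposition.** Let $F/K$ be a ramified $C_p$-extension with ramification break $b$, and let $a$ be an integer such that $a>b$ and $a\not\equiv 0,-b \pmod p$. Then there is a totally ramified extension $L/F$ such that $L/K$ is a totally ramified Galois extension with $\mathrm{Gal}(L/K)\cong H(1,1)$ and $$\mathcal U_{L/K}=\{b,\;a,\;a+p^{-1}b\}.$$ In particular, $L/K$ has an upper ramification break which is not an integer. -/

import Mathlib

open scoped WithZero

universe uK uL

/-! ### Normalized valuations

A discrete valuation is written multiplicatively, with values in `ℤᵐ⁰`; the additive valuation `n`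
of `x` corresponds to the value `WithZero.exp (-n)`. -/

/-- The additive valuation attached to `w : Valuation L ℤᵐ⁰`, with value `⊤` at `0`. -/
noncomputable def addOrd {L : Type uL} [Field L] (w : Valuation L ℤᵐ⁰) (x : L) : WithTop ℤ :=
  open Classical in if x = 0 then ⊤ else ((-WithZero.log (w x) : ℤ) : WithTop ℤ)

/-- A uniformizer for a normalized discrete valuation, that is, an element of additive
valuation `1`. -/
noncomputable def uniformizer {L : Type uL} [Field L] (w : Valuation L ℤᵐ⁰) : L :=
  Classical.epsilon fun π : L => w π = WithZero.exp (-1 : ℤ)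

/-- `w` is a valuation of `L` that extends the valuation `v` of `K` (up to equivalence), normalized
so that the additive valuation maps `Lˣ` onto `ℤ`. If `K` is complete with respect to the discrete
valuation `v` and `L / K` is finite, there is exactly one such `w`. -/
def IsNormalizedExtension {K : Type uK} [Field K] (v : Valuation K ℤᵐ⁰)
    {L : Type uL} [Field L] [Algebra K L] (w : Valuation L ℤᵐ⁰) : Prop :=
  Function.Surjective w ∧ v.IsEquiv (w.comap (algebraMap K L))

/-- The normalized valuation `v_L` of a finite extension `L` of the complete discretely valued
field `(K, v)`. (The value in the second branch is irrelevant: it is the trivial valuation.) -/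
noncomputable def normalizedValuation {K : Type uK} [Field K] (v : Valuation K ℤᵐ⁰)
    (L : Type uL) [Field L] [Algebra K L] : Valuation L ℤᵐ⁰ :=
  open Classical in
  if h : ∃ w : Valuation L ℤᵐ⁰, IsNormalizedExtension v w then h.choose else 1

/-- The ramification index `v_L(π_K)` of `L / K`, where `v` is the normalized valuation of `K`. -/
noncomputable def ramificationIndex {K : Type uK} [Field K] (v : Valuation K ℤᵐ⁰)
    (L : Type uL) [Field L] [Algebra K L] : ℤ :=
  -WithZero.log (normalizedValuation v L (algebraMap K L (uniformizer v)))

/-- `L / K` is ramified: the ramification index is greater than `1`. (Over a perfect residue field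
this is the negation of being unramified.) -/
def IsRamifiedExtension {K : Type uK} [Field K] (v : Valuation K ℤᵐ⁰)
    (L : Type uL) [Field L] [Algebra K L] : Prop :=
  1 < ramificationIndex v L

/-- The finite extension `L / K` is totally ramified: the ramification index is the degree. -/
def IsTotallyRamifiedExtension {K : Type uK} [Field K] (v : Valuation K ℤᵐ⁰)
    (L : Type uL) [Field L] [Algebra K L] : Prop :=
  FiniteDimensional K L ∧ ramificationIndex v L = (Module.finrank K L : ℤ)

/-! ### Lower and upper ramification breaks of a totally ramified Galois extension -/

section Breaks

variable {K : Type uK} [Field K] (v : Valuation K ℤᵐ⁰) (L : Type uL) [Field L] [Algebra K L]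

/-- The ramification number `i(σ) = v_L(σ(π_L) - π_L) - 1`; it is `⊤` for `σ = 1`. -/
noncomputable def ramificationNumber (σ : L ≃ₐ[K] L) : WithTop ℤ :=
  addOrd (normalizedValuation v L)
    (σ (uniformizer (normalizedValuation v L)) - uniformizer (normalizedValuation v L)) +
    ((-1 : ℤ) : WithTop ℤ)

/-- The lower ramification subgroup `G_x` (its underlying set) for integral `x ≥ 0`. -/
def lowerRamificationGroup (x : ℕ) : Set (L ≃ₐ[K] L) :=
  {σ | ((x : ℤ) : WithTop ℤ) ≤ ramificationNumber v L σ}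

/-- The set of lower ramification breaks: the numbers `i(σ)` for `σ ≠ 1`. -/
def lowerBreaks : Set ℕ :=
  {b | ∃ σ : L ≃ₐ[K] L, σ ≠ 1 ∧ ramificationNumber v L σ = ((b : ℤ) : WithTop ℤ)}

theorem lowerBreaks_finite [FiniteDimensional K L] : (lowerBreaks v L).Finite := by
  have h : (Set.range (ramificationNumber v L)).Finite := Set.finite_range _
  refine (h.preimage (f := fun b : ℕ => ((b : ℤ) : WithTop ℤ)) ?_).subset ?_
  · intro x _ y _ hxy
    simpa using hxy
  · rintro b ⟨σ, -, hσ⟩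
    exact ⟨σ, hσ⟩

/-- The multiplicity of a positive lower break `b`: the `d` with `|G_b : G_{b+1}| = p ^ d`. -/
noncomputable def lowerBreakMultiplicity (p : ℕ) (b : ℕ) : ℕ :=
  Nat.log p (Nat.card (lowerRamificationGroup v L b) /
    Nat.card (lowerRamificationGroup v L (b + 1)))

/-- The multiset of positive lower breaks, counted with multiplicities. -/
noncomputable def positiveLowerBreaks (p : ℕ) [FiniteDimensional K L] : Multiset ℕ :=
  ∑ b ∈ (lowerBreaks_finite v L).toFinset with 0 < b,
    Multiset.replicate (lowerBreakMultiplicity v L p b) b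

/-- The recursion for the positive upper breaks. On the sorted list `b₁ ≤ b₂ ≤ ⋯ ≤ bₙ`, started at
`i = 0`, `b₀ = 0`, `u₀ = 0`, it returns `u₁, …, uₙ` with `u₁ = b₁ / m` and
`u_{i+1} - u_i = (b_{i+1} - b_i) / (m p ^ i)`. -/
def upperBreaksAux (p m : ℕ) : ℕ → ℚ → ℚ → List ℕ → List ℚ
  | _, _, _, [] => []
  | i, b₀, u₀, b :: l =>
      (u₀ + ((b : ℚ) - b₀) / ((m : ℚ) * (p : ℚ) ^ i)) ::
        upperBreaksAux p m (i + 1) b (u₀ + ((b : ℚ) - b₀) / ((m : ℚ) * (p : ℚ) ^ i)) l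

/-- The multiset `U_{L/K}` of upper ramification breaks of the totally ramified Galois extension
`L / K` of degree `m p ^ n` with `p ∤ m`, where `p` is the residue characteristic. The break `0`
occurs (once) if and only if it is a lower break. -/
noncomputable def upperBreaks (p : ℕ) [FiniteDimensional K L] : Multiset ℚ :=
  (open Classical in if 0 ∈ lowerBreaks v L then {0} else 0) +
    (upperBreaksAux p
      (Module.finrank K L / p ^ padicValNat p (Module.finrank K L)) 0 0 0
      ((positiveLowerBreaks v L p).sort (· ≤ ·)) : Multiset ℚ)

end Breaks

/-! ### The Heisenberg group -/

/-- The Heisenberg group `H(1,1)` of order `p ^ 3`. The triple `(i, j, k)` is the element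
`y ^ j x ^ i z ^ k`, where `x`, `y`, `z` have order `p` (for odd primes `p`), `z` is central and
`[x, y] = x y x⁻¹ y⁻¹ = z`. -/
@[ext]
structure Heisenberg (p : ℕ) where
  x : ZMod p
  y : ZMod p
  z : ZMod p

namespace Heisenberg

variable {p : ℕ}

instance : Mul (Heisenberg p) := ⟨fun g h => ⟨g.x + h.x, g.y + h.y, g.z + h.z + g.x * h.y⟩⟩
instance : One (Heisenberg p) := ⟨⟨0, 0, 0⟩⟩
instance : Inv (Heisenberg p) := ⟨fun g => ⟨-g.x, -g.y, -g.z + g.x * g.y⟩⟩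

theorem mul_def (g h : Heisenberg p) :
    g * h = ⟨g.x + h.x, g.y + h.y, g.z + h.z + g.x * h.y⟩ := rfl
theorem one_def : (1 : Heisenberg p) = ⟨0, 0, 0⟩ := rfl
theorem inv_def (g : Heisenberg p) : g⁻¹ = ⟨-g.x, -g.y, -g.z + g.x * g.y⟩ := rfl

instance : Group (Heisenberg p) :=
  Group.ofLeftAxioms
    (fun a b c => by simp only [mul_def]; ext <;> simp only <;> ring)
    (fun a => by simp only [mul_def, one_def]; ext <;> simp only <;> ring)
    (fun a => by simp only [mul_def, one_def, inv_def]; ext <;> simp only <;> ring)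

end Heisenberg

/-!
Write `wp x = x ^ p - x`. The extension `L / K` is built by three Artin–Schreier steps
`K ⊂ F = K(x) ⊂ M = F(y) ⊂ L = M(z)` with
`wp x = β`, `wp y = α`, `wp z = α x + γ`, where `α, β, γ ∈ K`.

**The group.** Conjugates of `x` over `K` are the `x + i` with `i` in the prime field, and likewise
for `y`. An automorphism with `x ↦ x + i`, `y ↦ y + j` sends `wp z` to `wp z + i α = wp (z + i y)`,
hence `z ↦ z + i y + k`. So `L / K` is normal, and the composition law of the triples `(j, i, k)` is
that of the Heisenberg group (`HeisenbergGenerators`).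

**The breaks.** Suppose that each step can be rewritten with a reduced generator, that is, with
`wp x`, `wp (y - f)` and `wp (z - h)` of pole orders `b₁ < b₂ < b₃` prime to `p` (`f ∈ F`,
`h ∈ M`). Then every step is totally ramified of degree `p` (`totallyRamified_of_wp`), and the lower
breaks of `L / K` are `b₁, b₂, b₃`: if `σ` is not the identity on `F`, it moves the generator `x` by
a unit, and the expansion of elements in powers of `x`, whose terms have distinct valuations, shows
that `σ` moves every element whose valuation is prime to `p` by the same relative amount
(`val_map_sub_algebraMap`). This applies to `wp (y - f) ∈ F`, hence determines the displacement of
`y - f` and then, in the same way, that of `z - h`. If `σ` fixes `F` or `M`, start with `y - f` or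
`z - h`. The upper breaks follow by the recursion
(`upperBreaks_eq_of_heisenbergBreak`).

**The choice of constants.** `F = K(x)` for a suitable `β` of pole order `b`: a cyclic extension of
degree `p` is an Artin–Schreier extension, `β` is changed by elements `wp c` until its pole order is
prime to `p`, and if it became integral, `F / K` would be unramified, by completeness of `K`
(`exists_ramified_generator`). Choose `s` with `s b ≡ a` modulo `p`, and put
`α = ω ^ p β ^ s` of pole order `a` and `γ = α β / (s + 1)`. The condition `a ≢ 0` gives `p ∤ s`,
the condition `a ≢ -b` gives `p ∤ s + 1`.

If `N' = N(t)` with `wp t` of pole order `l` prime to `p`, then every element of `N` of pole order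
`d > l` prime to `p` is congruent modulo `wp N'` to an element of pole order `p d - (p - 1) l` in
`N'` (`exists_val_sub_wp_eq`): an element of `N` is a sum of terms `ρ ^ p τ ^ j` with `τ = wp t`,
up to smaller terms, and `ρ ^ p τ ^ j - wp (ρ t ^ j)` has a lower pole order, its main term being
`-j ρ ^ p t ^ (p (j - 1) + 1)`. For `α` over `F` this yields `b₂ = p a - (p - 1) b`. The
constant `α x + γ` has, by the choice of `γ`, the two largest contributions cancelled after
subtraction of `wp (ω x ^ (s + 1) / (s + 1))`: its pole order becomes `d = p a - (p - 2) b` in `F`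
(`val_heisenberg_constant`), and reduction over `M` gives `b₃ = p d - (p - 1) b₂ = p a + b`. The
upper breaks are then `b`, `b + (b₂ - b) / p = a` and `a + (b₃ - b₂) / p ^ 2 = a + b / p`.
-/

namespace ArtinSchreier

open WithZero

/-! ### Discrete valuations in characteristic `p` -/

section Basic

variable {K : Type uK} [Field K] {L : Type uL} [Field L] [Algebra K L]

theorem exists_eq_exp (w : Valuation L ℤᵐ⁰) {x : L} (hx : x ≠ 0) : ∃ m : ℤ, w x = exp m :=
  ⟨log (w x), (exp_log ((Valuation.ne_zero_iff w).2 hx)).symm⟩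

theorem ne_zero_of_eq_exp {w : Valuation L ℤᵐ⁰} {x : L} {m : ℤ} (h : w x = exp m) : x ≠ 0 := by
  rintro rfl
  rw [map_zero] at h
  exact exp_ne_zero h.symm

theorem exp_pow_eq (m : ℤ) (n : ℕ) : (exp m : ℤᵐ⁰) ^ n = exp (n * m) := by
  rw [← exp_nsmul, nsmul_eq_mul]

theorem eq_exp_of_pow_eq {g : ℤᵐ⁰} {n : ℕ} (hn : n ≠ 0) {m : ℤ} (h : g ^ n = exp (n * m)) :
    g = exp m := by
  have hg : g ≠ 0 := by
    rintro rfl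
    rw [zero_pow hn] at h
    exact exp_ne_zero h.symm
  rw [← exp_log hg, exp_pow_eq, exp_inj] at h
  rw [← exp_log hg, exp_inj]
  exact mul_left_cancel₀ (by exact_mod_cast hn) h

/-- The value group of a valuation extending a normalized one: the restriction is a power, whose
exponent is the ramification index. -/
theorem exists_exponent {v : Valuation K ℤᵐ⁰} (hv : Function.Surjective v) {w : Valuation L ℤᵐ⁰}
    (h : v.IsEquiv (w.comap (algebraMap K L))) :
    ∃ e : ℕ, 0 < e ∧ ∀ a, w (algebraMap K L a) = v a ^ e := by
  obtain ⟨π, hπ⟩ := hv (exp (-1))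
  have hπ0 : π ≠ 0 := ne_zero_of_eq_exp hπ
  obtain ⟨k, hk⟩ := exists_eq_exp w (x := algebraMap K L π) (by simpa using hπ0)
  have hk0 : k < 0 := by
    have : (w.comap (algebraMap K L)) π < 1 := h.lt_one_iff_lt_one.1 (by
      rw [hπ, ← exp_zero, exp_lt_exp]; norm_num)
    rw [Valuation.comap_apply, hk, ← exp_zero, exp_lt_exp] at this
    exact this
  refine ⟨(-k).toNat, by omega, fun a => ?_⟩
  rcases eq_or_ne a 0 with rfl | ha
  · simp [show (-k).toNat ≠ 0 by omega]
  obtain ⟨m, hm⟩ := exists_eq_exp v ha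
  have h1 : v (a * π ^ m) = 1 := by
    rw [map_mul, map_zpow₀, hm, hπ, ← exp_zsmul, ← exp_add]
    simp
  have h2 := h.eq_one_iff_eq_one.1 h1
  rw [Valuation.comap_apply, map_mul, map_mul, map_zpow₀, map_zpow₀, hk, ← exp_zsmul] at h2
  rw [eq_inv_of_mul_eq_one_left h2, hm, exp_pow_eq, ← exp_neg, exp_inj, smul_eq_mul,
    Int.toNat_of_nonneg (by omega)]
  ring

theorem isEquiv_of_map_eq_pow {v : Valuation K ℤᵐ⁰} {w : Valuation L ℤᵐ⁰} {e : ℕ} (he : e ≠ 0)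
    (h : ∀ a, w (algebraMap K L a) = v a ^ e) : v.IsEquiv (w.comap (algebraMap K L)) := by
  intro a b
  rw [Valuation.comap_apply, Valuation.comap_apply, h, h]
  exact (pow_le_pow_iff_left₀ zero_le zero_le he).symm

/-- Two equivalent valuations with value group exactly `ℤ` agree. -/
theorem eq_of_isEquiv {w w' : Valuation L ℤᵐ⁰} (hw : Function.Surjective w)
    (hw' : Function.Surjective w') (h : w.IsEquiv w') : w' = w := by
  obtain ⟨e, he, H⟩ := exists_exponent (K := L) (L := L) hw (w := w') (by simpa using h)
  simp only [Algebra.algebraMap_self, RingHom.id_apply] at H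
  obtain ⟨x, hx⟩ := hw' (exp 1)
  have hx0 := ne_zero_of_eq_exp hx
  obtain ⟨m, hm⟩ := exists_eq_exp w hx0
  rw [H, hm, exp_pow_eq, exp_inj] at hx
  have : e = 1 := by
    have : (e : ℤ) ∣ 1 := ⟨m, hx.symm⟩
    have := Int.natAbs_dvd_natAbs.2 this
    simpa using this
  ext a
  simp [H, this]

/-- The geometric sum `1 + (1 + ε) + ⋯ + (1 + ε) ^ (i - 1)` is `i` up to a topologically nilpotent
error. -/
theorem val_one_add_pow_sub_one_le {w : Valuation L ℤᵐ⁰} {ε : L} (hε : w ε < 1) (i : ℕ) :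
    w ((1 + ε) ^ i - 1) ≤ w ε := by
  have h1 : w (1 + ε) ≤ 1 := (Valuation.map_add_le w (by simp) hε.le)
  induction i with
  | zero => simp
  | succ i ih =>
    have : (1 + ε) ^ (i + 1) - 1 = (1 + ε) * ((1 + ε) ^ i - 1) + ε := by ring
    rw [this]
    refine Valuation.map_add_le w ?_ le_rfl
    rw [map_mul]
    exact (mul_le_of_le_one_left' h1).trans ih

theorem val_one_add_pow_sub_one_sub_lt {w : Valuation L ℤᵐ⁰} {ε : L} (hε : w ε < 1)
    (hε0 : ε ≠ 0) (i : ℕ) : w ((1 + ε) ^ i - 1 - i * ε) < w ε := by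
  have hp : 0 < w ε := (Valuation.pos_iff w).2 hε0
  induction i with
  | zero => simpa using hp
  | succ i ih =>
    have : (1 + ε) ^ (i + 1) - 1 - (i + 1 : ℕ) * ε
      = ((1 + ε) ^ i - 1 - i * ε) + ε * ((1 + ε) ^ i - 1) := by push_cast; ring
    rw [this]
    refine Valuation.map_add_lt w ih ?_
    rw [map_mul]
    calc w ε * w ((1 + ε) ^ i - 1) ≤ w ε * w ε := by
          gcongr; exact val_one_add_pow_sub_one_le hε i
      _ < w ε * 1 := by gcongr
      _ = w ε := mul_one _

theorem val_one_add_pow_sub_one_eq {w : Valuation L ℤᵐ⁰} {ε : L} (hε : w ε < 1) {i : ℕ}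
    (hi : w (i : L) = 1) : w ((1 + ε) ^ i - 1) = w ε := by
  rcases eq_or_ne ε 0 with rfl | hε0
  · simp
  have h := val_one_add_pow_sub_one_sub_lt hε hε0 i
  have h' : w ((i : L) * ε) = w ε := by rw [map_mul, hi, one_mul]
  rw [← h'] at h ⊢
  exact Valuation.map_eq_of_sub_lt w h

/-- Homogeneous form of `val_one_add_pow_sub_one_le`. -/
theorem val_add_pow_sub_pow_le {w : Valuation L ℤᵐ⁰} {A u : L} {g : ℤᵐ⁰} (hg : g < 1)
    (h : w u = g * w A) (i : ℕ) : w ((A + u) ^ i - A ^ i) ≤ g * w (A ^ i) := by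
  rcases eq_or_ne A 0 with rfl | hA
  · have : u = 0 := by simpa using h
    simp [this]
  have hA' : w A ≠ 0 := (Valuation.ne_zero_iff w).2 hA
  have hε : w (u / A) = g := by rw [map_div₀, h, mul_div_cancel_right₀ _ hA']
  have : (A + u) ^ i - A ^ i = A ^ i * ((1 + u / A) ^ i - 1) := by
    rw [mul_sub, ← mul_pow, mul_add, mul_div_cancel₀ _ hA]; simp
  rw [this, map_mul, mul_comm]
  gcongr
  exact (val_one_add_pow_sub_one_le (by rwa [hε]) i).trans hε.le

theorem val_add_pow_sub_pow_eq {w : Valuation L ℤᵐ⁰} {A u : L} {g : ℤᵐ⁰} (hg : g < 1)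
    (h : w u = g * w A) {i : ℕ} (hi : w (i : L) = 1) :
    w ((A + u) ^ i - A ^ i) = g * w (A ^ i) := by
  rcases eq_or_ne A 0 with rfl | hA
  · have : u = 0 := by simpa using h
    rcases eq_or_ne i 0 with rfl | hi0
    · simp at hi
    · simp [this, hi0]
  have hA' : w A ≠ 0 := (Valuation.ne_zero_iff w).2 hA
  have hε : w (u / A) = g := by rw [map_div₀, h, mul_div_cancel_right₀ _ hA']
  have : (A + u) ^ i - A ^ i = A ^ i * ((1 + u / A) ^ i - 1) := by
    rw [mul_sub, ← mul_pow, mul_add, mul_div_cancel₀ _ hA]; simp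
  rw [this, map_mul, mul_comm, val_one_add_pow_sub_one_eq (by rwa [hε]) hi, hε]

end Basic

section CharP

variable {L : Type uL} [Field L] (p : ℕ)

/-- The Artin–Schreier map `x ↦ x ^ p - x`. -/
def wp (x : L) : L := x ^ p - x

theorem map_wp {M : Type*} [Field M] {F : Type*} [FunLike F L M] [RingHomClass F L M] (f : F)
    (x : L) : f (wp p x) = wp p (f x) := by
  simp [wp]

theorem pow_of_wp_eq_zero {u : L} (h : wp p u = 0) : u ^ p = u := sub_eq_zero.1 h

theorem val_eq_one_of_wp_eq_zero {p : ℕ} [Fact p.Prime] (w : Valuation L ℤᵐ⁰) {u : L}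
    (h : wp p u = 0) (hu : u ≠ 0) :
    w u = 1 := by
  have h1 : w u ^ p = w u := by rw [← map_pow, pow_of_wp_eq_zero p h]
  have hp := (Fact.out : p.Prime).two_le
  obtain ⟨m, hm⟩ := exists_eq_exp w hu
  rw [hm, exp_pow_eq, exp_inj] at h1
  have : ((p : ℤ) - 1) * m = 0 := by linear_combination h1
  rcases mul_eq_zero.1 this with h2 | h2
  · omega
  · rw [hm, h2, exp_zero]

theorem val_wp_of_one_lt {p : ℕ} [Fact p.Prime] (w : Valuation L ℤᵐ⁰) {z : L} (hz : 1 < w z) :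
    w (wp p z) = w z ^ p := by
  have : w z < w (z ^ p) := by
    rw [map_pow]
    simpa using pow_lt_pow_right₀ hz (Fact.out : p.Prime).one_lt
  rw [← map_pow, wp, Valuation.map_sub_eq_of_lt_left w this]

/-- A pole of `x ^ p - x` is a pole of `x ^ p` of the same order. -/
theorem val_pow_eq_val_wp {p : ℕ} [Fact p.Prime] (w : Valuation L ℤᵐ⁰) {z : L}
    (h : 1 < w (wp p z)) :
    w z ^ p = w (wp p z) := by
  refine (val_wp_of_one_lt w ?_).symm
  by_contra! hz
  exact absurd (Valuation.map_sub_le (v := w) (x := z ^ p) (y := z) (g := 1)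
    (by rw [map_pow]; exact pow_le_one' hz p) hz) (not_le.2 h)

theorem val_eq_of_val_wp {p : ℕ} [Fact p.Prime] (w : Valuation L ℤᵐ⁰) {z : L} {m : ℤ} (hm : 0 < m)
    (h : w (wp p z) = exp (p * m)) : w z = exp m := by
  have hp := (Fact.out : p.Prime).pos
  refine eq_exp_of_pow_eq hp.ne' (n := p) ?_
  rw [val_pow_eq_val_wp w, h]
  rw [h, ← exp_zero, exp_lt_exp]
  positivity

variable [Fact p.Prime] [CharP L p]

theorem wp_add (x y : L) : wp p (x + y) = wp p x + wp p y := by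
  simp only [wp, add_pow_char]; ring

theorem wp_sub (x y : L) : wp p (x - y) = wp p x - wp p y := by
  simp only [wp, sub_pow_char]; ring

/-- The kernel of the Artin–Schreier map is the prime field. -/
theorem exists_cast_of_wp_eq_zero {u : L} (h : wp p u = 0) :
    ∃ i : ZMod p, ZMod.castHom (dvd_refl p) L i = u := by
  have h1 := (Subfield.mem_bot_iff_pow_eq_self (F := L) (p := p)).2 (pow_of_wp_eq_zero p h)
  rwa [← ZMod.fieldRange_castHom_eq_bot p, RingHom.mem_fieldRange] at h1

theorem wp_castHom (i : ZMod p) : wp p (ZMod.castHom (dvd_refl p) L i) = 0 := by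
  rw [wp, ← map_pow, ZMod.pow_card, sub_self]

variable {p}

theorem val_natCast_eq_one (w : Valuation L ℤᵐ⁰) {i : ℕ} (hi : ¬ p ∣ i) : w (i : L) = 1 := by
  refine val_eq_one_of_wp_eq_zero (p := p) w ?_ (by rwa [Ne, CharP.cast_eq_zero_iff L p])
  have := wp_castHom (L := L) p (i : ZMod p)
  simpa using this

end CharP

/-! ### Totally ramified extensions -/

section TotallyRamified

variable {K : Type uK} [Field K] {L : Type uL} [Field L] [Algebra K L]

/-- `(L, w)` is a totally ramified finite extension of the discretely valued field `(K, v)`: on `K`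
the normalized valuation `w` is the `[L : K]`-th power of `v`. -/
structure TotallyRamified (v : Valuation K ℤᵐ⁰) (w : Valuation L ℤᵐ⁰) : Prop where
  finiteDimensional : FiniteDimensional K L
  surjective : Function.Surjective w
  map_algebraMap : ∀ a, w (algebraMap K L a) = v a ^ Module.finrank K L

variable {v : Valuation K ℤᵐ⁰} {w : Valuation L ℤᵐ⁰} {n : ℕ} {y : L} {m : ℤ}

/-- If the value of `y` is prime to the ramification index `n`, the terms of a polynomial of degree
less than `n` in `y` have distinct values, so one of them dominates. -/
theorem exists_dominant_term (hmap : ∀ a, w (algebraMap K L a) = v a ^ n)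
    (hy : w y = exp m) (hm : IsCoprime m n) (a : ℕ → K) (ha : ∃ i ∈ Finset.range n, a i ≠ 0) :
    ∃ i ∈ Finset.range n, a i ≠ 0 ∧ ∀ j ∈ Finset.range n, j ≠ i →
      w (algebraMap K L (a j) * y ^ j) < w (algebraMap K L (a i) * y ^ i) := by
  obtain ⟨i₁, hi₁, ha₁⟩ := ha
  have hy0 : y ≠ 0 := ne_zero_of_eq_exp hy
  obtain ⟨i, hi, hmax⟩ := Finset.exists_max_image (Finset.range n)
    (fun i => w (algebraMap K L (a i) * y ^ i)) ⟨i₁, hi₁⟩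
  have hpos : 0 < w (algebraMap K L (a i) * y ^ i) := by
    refine lt_of_lt_of_le ?_ (hmax i₁ hi₁)
    rw [Valuation.pos_iff]
    exact mul_ne_zero (by simpa using ha₁) (pow_ne_zero _ hy0)
  have hai : a i ≠ 0 := by
    intro h
    simp [h] at hpos
  refine ⟨i, hi, hai, fun j hj hji => lt_of_le_of_ne (hmax j hj) fun heq => hji ?_⟩
  have haj : a j ≠ 0 := by
    intro h
    rw [← heq] at hpos
    simp [h] at hpos
  obtain ⟨k, hk⟩ := exists_eq_exp v hai
  obtain ⟨l, hl⟩ := exists_eq_exp v haj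
  rw [map_mul, map_mul, map_pow, map_pow, hmap, hmap, hk, hl, hy, exp_pow_eq, exp_pow_eq,
    exp_pow_eq, exp_pow_eq, ← exp_add, ← exp_add, exp_inj] at heq
  have hdvd : (n : ℤ) ∣ ((j : ℤ) - i) * m := ⟨k - l, by linear_combination heq⟩
  have hdvd' : (n : ℤ) ∣ (j : ℤ) - i := hm.symm.dvd_of_dvd_mul_right hdvd
  have h1 := Int.eq_zero_of_abs_lt_dvd hdvd' (by
    rw [abs_lt]
    have := Finset.mem_range.1 hi
    have := Finset.mem_range.1 hj
    omega)
  omega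

theorem val_sum_eq_dominant {a : ℕ → K} {i : ℕ} (hi : i ∈ Finset.range n)
    (h : ∀ j ∈ Finset.range n, j ≠ i →
      w (algebraMap K L (a j) * y ^ j) < w (algebraMap K L (a i) * y ^ i)) :
    w (∑ j ∈ Finset.range n, algebraMap K L (a j) * y ^ j) = w (algebraMap K L (a i) * y ^ i) := by
  refine Valuation.map_sum_eq_of_lt w hi fun j hj => ?_
  rw [Finset.mem_sdiff, Finset.mem_singleton] at hj
  exact h j hj.1 hj.2

theorem linearIndependent_pow_of_isCoprime (hmap : ∀ a, w (algebraMap K L a) = v a ^ n)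
    (hy : w y = exp m) (hm : IsCoprime m n) : LinearIndependent K fun i : Fin n => y ^ (i : ℕ) := by
  rw [Fintype.linearIndependent_iff]
  intro g hg
  by_contra! hne
  obtain ⟨i₀, hi₀⟩ := hne
  set a : ℕ → K := fun i => if h : i < n then g ⟨i, h⟩ else 0 with ha
  have hag : ∀ i : Fin n, a i = g i := fun i => by simp [ha]
  obtain ⟨i, hi, hai, hlt⟩ := exists_dominant_term hmap hy hm a
    ⟨i₀, Finset.mem_range.2 i₀.2, by rwa [hag]⟩
  have h := val_sum_eq_dominant hi hlt
  have hsum : ∑ j ∈ Finset.range n, algebraMap K L (a j) * y ^ j = 0 := by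
    rw [← hg, Finset.sum_range]
    exact Finset.sum_congr rfl fun j _ => by rw [hag, Algebra.smul_def]
  rw [hsum, map_zero] at h
  have := (Valuation.zero_iff w).1 h.symm
  rcases mul_eq_zero.1 this with h1 | h1
  · exact hai (by simpa using h1)
  · exact pow_ne_zero _ (ne_zero_of_eq_exp hy) h1

/-- The ramification index is at most the degree. -/
theorem exponent_le_finrank [FiniteDimensional K L] (hmap : ∀ a, w (algebraMap K L a) = v a ^ n)
    (hw : Function.Surjective w) : n ≤ Module.finrank K L := by
  obtain ⟨π, hπ⟩ := hw (exp 1)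
  have := (linearIndependent_pow_of_isCoprime hmap hπ isCoprime_one_left).fintype_card_le_finrank
  simpa using this

namespace TotallyRamified

theorem isEquiv (h : TotallyRamified v w) : v.IsEquiv (w.comap (algebraMap K L)) :=
  have := h.finiteDimensional
  isEquiv_of_map_eq_pow Module.finrank_pos.ne' h.map_algebraMap

/-- In a totally ramified extension, an element whose value is prime to the degree generates. -/
theorem exists_sum_eq (h : TotallyRamified v w) (hy : w y = exp m)
    (hm : IsCoprime m (Module.finrank K L)) (x : L) :
    ∃ a : ℕ → K, x = ∑ i ∈ Finset.range (Module.finrank K L), algebraMap K L (a i) * y ^ i := by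
  have := h.finiteDimensional
  have hli := linearIndependent_pow_of_isCoprime h.map_algebraMap hy hm
  have : Nonempty (Fin (Module.finrank K L)) := ⟨0, Module.finrank_pos⟩
  have hspan := hli.span_eq_top_of_card_eq_finrank (by simp)
  obtain ⟨c, hc⟩ := (Submodule.mem_span_range_iff_exists_fun K).1
    (show x ∈ Submodule.span K _ from hspan ▸ Submodule.mem_top)
  refine ⟨fun i => if hi : i < Module.finrank K L then c ⟨i, hi⟩ else 0, ?_⟩
  rw [← hc, Finset.sum_range]
  exact Finset.sum_congr rfl fun j _ => by simp [Algebra.smul_def]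

theorem exists_sum_dominant (h : TotallyRamified v w) (hy : w y = exp m)
    (hm : IsCoprime m (Module.finrank K L)) {x : L} (hx : x ≠ 0) :
    ∃ a : ℕ → K, x = ∑ i ∈ Finset.range (Module.finrank K L), algebraMap K L (a i) * y ^ i ∧
      ∃ i ∈ Finset.range (Module.finrank K L), w x = w (algebraMap K L (a i) * y ^ i) ∧
      ∀ j ∈ Finset.range (Module.finrank K L), j ≠ i →
      w (algebraMap K L (a j) * y ^ j) < w (algebraMap K L (a i) * y ^ i) := by
  obtain ⟨a, ha⟩ := h.exists_sum_eq hy hm x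
  have hne : ∃ i ∈ Finset.range (Module.finrank K L), a i ≠ 0 := by
    by_contra! hall
    exact hx (ha.trans (Finset.sum_eq_zero fun i hi => by simp [hall i hi]))
  obtain ⟨i, hi, -, hlt⟩ := exists_dominant_term h.map_algebraMap hy hm a hne
  exact ⟨a, ha, i, hi, ha ▸ val_sum_eq_dominant hi hlt, hlt⟩

/-- A totally ramified extension carries only one normalized valuation extending `v`. The powers of
an integral element `x` are combinations of a fixed basis with bounded coefficients, so `x` stays
integral for every other extension. -/
theorem eq_of_isEquiv (hv : Function.Surjective v) (h : TotallyRamified v w) {w' : Valuation L ℤᵐ⁰}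
    (hw' : Function.Surjective w') (he : v.IsEquiv (w'.comap (algebraMap K L))) : w' = w := by
  have := h.finiteDimensional
  obtain ⟨y, hy⟩ := h.surjective (exp (-1))
  have hy0 := ne_zero_of_eq_exp hy
  have hm : IsCoprime (-1 : ℤ) (Module.finrank K L) := isCoprime_one_left.neg_left
  have hn : 0 < Module.finrank K L := Module.finrank_pos
  set n := Module.finrank K L with hndef
  have key : ∀ x, w x ≤ 1 → w' x ≤ 1 := by
    intro x hx
    by_contra! hlt
    obtain ⟨i₀, -, hmax⟩ := Finset.exists_max_image (Finset.range n) (fun i => w' (y ^ i))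
      ⟨0, Finset.mem_range.2 hn⟩
    have hbound : ∀ z, w z ≤ 1 → w' z ≤ w' (y ^ i₀) := by
      intro z hz
      rcases eq_or_ne z 0 with rfl | hz0
      · simp
      obtain ⟨a, ha, i, hi, hwi, hlti⟩ := h.exists_sum_dominant hy hm hz0
      rw [ha]
      refine Valuation.map_sum_le w' fun j hj => ?_
      have h1 : w (algebraMap K L (a j) * y ^ j) ≤ 1 := by
        rcases eq_or_ne j i with rfl | hji
        · exact hwi ▸ hz
        · exact (hlti j hj hji).le.trans (hwi ▸ hz)
      have h2 : v (a j) ≤ 1 := by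
        rcases eq_or_ne (a j) 0 with h0 | h0
        · simp [h0]
        obtain ⟨k, hk⟩ := exists_eq_exp v h0
        rw [map_mul, map_pow, h.map_algebraMap, hk, hy, exp_pow_eq, exp_pow_eq, ← exp_add,
          ← exp_zero, exp_le_exp] at h1
        rw [hk, ← exp_zero, exp_le_exp]
        have hj' : (j : ℤ) < n := by exact_mod_cast Finset.mem_range.1 hj
        by_contra! hk0
        nlinarith
      have h3 : w' (algebraMap K L (a j)) ≤ 1 := he.le_one_iff_le_one.1 h2
      rw [map_mul]
      exact (mul_le_of_le_one_left' h3).trans (hmax j hj)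
    obtain ⟨k, hk⟩ := exists_eq_exp w' (x := x) (by rintro rfl; simp at hlt)
    obtain ⟨l, hl⟩ := exists_eq_exp w' (x := y ^ i₀) (pow_ne_zero _ hy0)
    have h4 := hbound (x ^ (l.toNat + 1)) (by rw [map_pow]; exact pow_le_one' hx _)
    rw [map_pow, hl, hk, exp_pow_eq, exp_le_exp] at h4
    rw [hk, ← exp_zero, exp_lt_exp] at hlt
    have h5 : l ≤ l.toNat := Int.self_le_toNat l
    push_cast at h4
    nlinarith
  refine ArtinSchreier.eq_of_isEquiv h.surjective hw'
    (Valuation.isEquiv_of_val_le_one fun x => ⟨key x, ?_⟩)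
  contrapose!
  intro hx
  have hx0 : x ≠ 0 := by rintro rfl; simp at hx
  obtain ⟨π, hπ⟩ := hv (exp 1)
  obtain ⟨k, hk⟩ := exists_eq_exp w hx0
  have hk0 : 0 < k := by rwa [hk, ← exp_zero, exp_lt_exp] at hx
  have h1 : w (algebraMap K L π * (x ^ n)⁻¹) ≤ 1 := by
    rw [map_mul, map_inv₀, map_pow, h.map_algebraMap, hπ, hk, exp_pow_eq, exp_pow_eq, ← exp_neg,
      ← exp_add, ← exp_zero, exp_le_exp]
    nlinarith
  have h2 := key _ h1
  have h3 : 1 < w' (algebraMap K L π) := he.one_lt_iff_one_lt.1 (by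
    rw [hπ, ← exp_zero, exp_lt_exp]; norm_num)
  by_contra! h4
  have h5 : algebraMap K L π = (algebraMap K L π * (x ^ n)⁻¹) * x ^ n := by field_simp
  rw [h5, map_mul, map_pow] at h3
  exact absurd (mul_le_one' h2 (pow_le_one' h4 n)) (not_le.2 h3)

theorem trans {M : Type*} [Field M] [Algebra L M] [Algebra K M] [IsScalarTower K L M]
    {u : Valuation M ℤᵐ⁰} (h : TotallyRamified v w) (h' : TotallyRamified w u) :
    TotallyRamified v u := by
  have := h.finiteDimensional
  have := h'.finiteDimensional
  refine ⟨FiniteDimensional.trans K L M, h'.surjective, fun a => ?_⟩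
  rw [IsScalarTower.algebraMap_apply K L M, h'.map_algebraMap, h.map_algebraMap, ← pow_mul,
    Module.finrank_mul_finrank]

end TotallyRamified

/-- Let `M` be totally ramified of degree `p ^ k > 1`. If a homomorphism `σ` displaces one element
`y`, of value prime to `p`, by the amount `c > 0` relative to the value of `y`, then it displaces
every element of value prime to `p` by the same relative amount, as `y` generates `M`. Here
`σ` and the inclusion both take values in an extension `L` of `M` of ramification index `r`. -/
theorem val_map_sub_algebraMap {M : Type*} [Field M] [Algebra K M] [Algebra M L]
    [IsScalarTower K M L] {p : ℕ} [Fact p.Prime] [CharP L p] {u : Valuation M ℤᵐ⁰}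
    (h : TotallyRamified v u) {k : ℕ} (hk : 0 < k) (hn : Module.finrank K M = p ^ k)
    {r : ℕ} (hr : 0 < r) (hmap : ∀ a, w (algebraMap M L a) = u a ^ r) (σ : M →ₐ[K] L)
    {y : M} {m c : ℤ} (hc : 0 < c) (hy : u y = exp m) (hm : ¬ (p : ℤ) ∣ m)
    (hσ : w (σ y - algebraMap M L y) = exp (r * (m - c)))
    {x : M} {l : ℤ} (hx : u x = exp l) (hl : ¬ (p : ℤ) ∣ l) :
    w (σ x - algebraMap M L x) = exp (r * (l - c)) := by
  have hp : p.Prime := Fact.out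
  have hcop : IsCoprime m (Module.finrank K M) := by
    rw [hn]
    push_cast
    exact ((Nat.prime_iff_prime_int.1 hp).coprime_iff_not_dvd.2 hm).symm.pow_right
  obtain ⟨a, ha, i, hi, hui, hlt⟩ := h.exists_sum_dominant hy hcop (ne_zero_of_eq_exp hx)
  set g : ℤᵐ⁰ := exp (-(r * c)) with hg
  have hg1 : g < 1 := by
    rw [hg, ← exp_zero, exp_lt_exp, neg_lt_zero]
    positivity
  have hg0 : 0 < g := by rw [hg]; exact exp_pos
  have hdiff : w (σ y - algebraMap M L y) = g * w (algebraMap M L y) := by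
    rw [hσ, hmap, hy, exp_pow_eq, hg, ← exp_add, exp_inj]; ring
  have hterm : ∀ j, σ (algebraMap K M (a j) * y ^ j) - algebraMap M L (algebraMap K M (a j) * y ^ j)
      = algebraMap K L (a j) * ((algebraMap M L y + (σ y - algebraMap M L y)) ^ j
        - algebraMap M L y ^ j) := by
    intro j
    rw [map_mul, map_mul, map_pow, map_pow, AlgHom.commutes, ← IsScalarTower.algebraMap_apply]
    ring
  have hterm' : ∀ j, g * w (algebraMap M L (algebraMap K M (a j) * y ^ j))
      = w (algebraMap K L (a j)) * (g * w (algebraMap M L y ^ j)) := by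
    intro j
    rw [map_mul, map_mul, map_pow, ← IsScalarTower.algebraMap_apply, mul_left_comm]
  have hle : ∀ j, w (σ (algebraMap K M (a j) * y ^ j) -
      algebraMap M L (algebraMap K M (a j) * y ^ j))
      ≤ g * w (algebraMap M L (algebraMap K M (a j) * y ^ j)) := by
    intro j
    rw [hterm, hterm', map_mul]
    gcongr
    exact val_add_pow_sub_pow_le hg1 hdiff j
  have hpi : ¬ p ∣ i := by
    intro hpi
    have hai : a i ≠ 0 := by
      rintro h0
      rw [h0, hx] at hui
      simp at hui
    obtain ⟨t, ht⟩ := exists_eq_exp v hai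
    rw [map_mul, map_pow, h.map_algebraMap, hn, ht, hy, hx, exp_pow_eq, exp_pow_eq, ← exp_add,
      exp_inj] at hui
    apply hl
    rw [hui]
    refine dvd_add (Dvd.dvd.mul_right ?_ _) (Dvd.dvd.mul_right ?_ _)
    · push_cast
      exact dvd_pow_self _ hk.ne'
    · exact_mod_cast hpi
  have heq : w (σ (algebraMap K M (a i) * y ^ i) -
      algebraMap M L (algebraMap K M (a i) * y ^ i))
      = g * w (algebraMap M L (algebraMap K M (a i) * y ^ i)) := by
    rw [hterm, hterm', map_mul, val_add_pow_sub_pow_eq hg1 hdiff (val_natCast_eq_one w hpi)]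
  have hsum : σ x - algebraMap M L x = ∑ j ∈ Finset.range (Module.finrank K M),
      (σ (algebraMap K M (a j) * y ^ j) - algebraMap M L (algebraMap K M (a j) * y ^ j)) := by
    rw [ha, map_sum, map_sum, Finset.sum_sub_distrib]
  rw [hsum, Valuation.map_sum_eq_of_lt w hi, heq, hmap, ← hui, hx, exp_pow_eq, hg, ← exp_add]
  · congr 1; ring
  · intro j hj
    rw [Finset.mem_sdiff, Finset.mem_singleton] at hj
    refine (hle j).trans_lt ?_
    rw [heq, hmap, hmap]
    have := pow_lt_pow_left₀ (hlt j hj.1 hj.2) zero_le hr.ne'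
    gcongr

end TotallyRamified

/-! ### Reduction of Artin–Schreier constants -/

section Reduction

/-- The `p`-th power map is surjective on the residue field of `w`. -/
def ResiduallyPerfect (p : ℕ) {L : Type uL} [Field L] (w : Valuation L ℤᵐ⁰) : Prop :=
  ∀ u, w u ≤ 1 → ∃ c, w (u - c ^ p) < 1

theorem residuallyPerfect_of_perfectField {p : ℕ} [Fact p.Prime] {K : Type uK} [Field K] [CharP K p]
    (v : Valuation K ℤᵐ⁰) [PerfectField (IsLocalRing.ResidueField v.valuationSubring)] :
    ResiduallyPerfect p v := by
  intro u hu
  have : CharP (IsLocalRing.ResidueField v.valuationSubring) p := by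
    have h0 : (p : v.valuationSubring) = 0 := Subtype.ext (by simp)
    have h1 : (p : IsLocalRing.ResidueField v.valuationSubring) = 0 := by
      rw [← map_natCast (IsLocalRing.residue v.valuationSubring), h0, map_zero]
    exact (CharP.charP_iff_prime_eq_zero Fact.out).2 h1
  have hf := (PerfectField.toPerfectRing (K := IsLocalRing.ResidueField v.valuationSubring)
    p).bijective_frobenius.2
  obtain ⟨c, hc⟩ := hf (IsLocalRing.residue v.valuationSubring ⟨u, hu⟩)
  obtain ⟨c, rfl⟩ := IsLocalRing.residue_surjective c
  refine ⟨c, ?_⟩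
  have hc' : IsLocalRing.residue v.valuationSubring (⟨u, hu⟩ - c ^ p) = 0 := by
    rw [map_sub, map_pow, sub_eq_zero]
    exact hc.symm
  rw [IsLocalRing.residue_eq_zero_iff] at hc'
  exact (Valuation.mem_maximalIdeal_iff K v).1 hc'

/-- A totally ramified extension has the same residue field. -/
theorem ResiduallyPerfect.of_totallyRamified {p : ℕ} [Fact p.Prime] {K : Type uK} [Field K]
    {L : Type uL} [Field L] [Algebra K L] {v : Valuation K ℤᵐ⁰} {w : Valuation L ℤᵐ⁰}
    (h : TotallyRamified v w) (hv : ResiduallyPerfect p v) : ResiduallyPerfect p w := by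
  intro u hu
  have hp := (Fact.out : p.Prime).ne_zero
  rcases hu.lt_or_eq with hlt | heq
  · exact ⟨0, by simpa [hp] using hlt⟩
  have := h.finiteDimensional
  have hn : 0 < Module.finrank K L := Module.finrank_pos
  obtain ⟨y, hy⟩ := h.surjective (exp (-1))
  obtain ⟨a, ha, i, hi, hui, hlt⟩ := h.exists_sum_dominant hy isCoprime_one_left.neg_left
    (x := u) (by rintro rfl; simp at heq)
  have hai : a i ≠ 0 := by
    rintro h0
    rw [h0, heq] at hui
    simp at hui
  have hi0 : i = 0 := by
    obtain ⟨t, ht⟩ := exists_eq_exp v hai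
    rw [heq, map_mul, map_pow, h.map_algebraMap, ht, hy, exp_pow_eq, exp_pow_eq, ← exp_add,
      ← exp_zero, exp_inj] at hui
    have hdvd : (Module.finrank K L : ℤ) ∣ i := ⟨t, by linear_combination hui⟩
    exact Nat.eq_zero_of_dvd_of_lt (Int.natCast_dvd_natCast.1 hdvd) (Finset.mem_range.1 hi)
  subst hi0
  rw [pow_zero, mul_one] at hui
  have hva : v (a 0) = 1 := by
    have h1 := hui.symm.trans heq
    rw [h.map_algebraMap] at h1
    exact (pow_eq_one_iff_of_nonneg zero_le hn.ne').1 h1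
  obtain ⟨c, hc⟩ := hv (a 0) hva.le
  refine ⟨algebraMap K L c, ?_⟩
  have h1 : w (u - algebraMap K L (a 0)) < 1 := by
    have h2 : u - algebraMap K L (a 0) = ∑ j ∈ Finset.range (Module.finrank K L) \ {0},
        algebraMap K L (a j) * y ^ j := by
      conv_lhs => rw [ha]
      rw [Finset.sum_eq_add_sum_sdiff_singleton_of_mem hi]
      simp
    rw [h2]
    refine Valuation.map_sum_lt w one_ne_zero fun j hj => ?_
    rw [Finset.mem_sdiff, Finset.mem_singleton] at hj
    refine (hlt j hj.1 hj.2).trans_le ?_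
    simp [← hui, heq]
  have h3 : u - algebraMap K L c ^ p =
      (u - algebraMap K L (a 0)) + algebraMap K L (a 0 - c ^ p) := by
    rw [map_sub, map_pow]; ring
  rw [h3]
  refine Valuation.map_add_lt w h1 ?_
  rw [h.map_algebraMap]
  exact pow_lt_one₀ zero_le hc hn.ne'

/-- Up to terms of smaller value, every element is a `p`-th power times a power of a fixed element
`τ` whose value is prime to `p`. -/
theorem exists_pow_mul_pow {p : ℕ} [Fact p.Prime] {N : Type uK} [Field N] {w : Valuation N ℤᵐ⁰}
    (hw : Function.Surjective w) (hperf : ResiduallyPerfect p w) {τ : N} {l : ℤ}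
    (hτ : w τ = exp l) (hl : ¬ (p : ℤ) ∣ l) {D : N} {d : ℤ} (hD : w D = exp d) :
    ∃ (j : ℕ) (ρ : N), (¬ (p : ℤ) ∣ d → ¬ p ∣ j) ∧ w (ρ ^ p * τ ^ j) = exp d ∧
      w (D - ρ ^ p * τ ^ j) < exp d := by
  have hp : p.Prime := Fact.out
  obtain ⟨s, t, hst⟩ := (Nat.prime_iff_prime_int.1 hp).coprime_iff_not_dvd.2 hl
  have hp0 : (0 : ℤ) < p := by exact_mod_cast hp.pos
  set j := ((t * d) % p).toNat with hj
  have hjz : (j : ℤ) = t * d - p * (t * d / p) := by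
    rw [hj, Int.toNat_of_nonneg (Int.emod_nonneg _ hp0.ne')]
    linear_combination Int.emod_add_mul_ediv (t * d) p
  have hk : d = p * (s * d + (t * d / p) * l) + j * l := by
    rw [hjz]; linear_combination -d * hst
  obtain ⟨ρ₀, hρ₀⟩ := hw (exp (s * d + (t * d / p) * l))
  have hval : w (ρ₀ ^ p * τ ^ j) = exp d := by
    rw [map_mul, map_pow, map_pow, hρ₀, hτ, exp_pow_eq, exp_pow_eq, ← exp_add, ← hk]
  have hne := ne_zero_of_eq_exp hval
  obtain ⟨c, hc⟩ := hperf (D / (ρ₀ ^ p * τ ^ j)) (by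
    rw [map_div₀, hD, hval, div_self exp_ne_zero])
  refine ⟨j, c * ρ₀, fun hd hpj => hd ?_, ?_⟩
  · rw [hk]
    exact dvd_add (dvd_mul_right _ _) (Dvd.dvd.mul_right (by exact_mod_cast hpj) _)
  have hlt : w (D - (c * ρ₀) ^ p * τ ^ j) < exp d := by
    have : D - (c * ρ₀) ^ p * τ ^ j = (D / (ρ₀ ^ p * τ ^ j) - c ^ p) * (ρ₀ ^ p * τ ^ j) := by
      rw [sub_mul, div_mul_cancel₀ _ hne]; ring
    rw [this, map_mul, hval]
    exact mul_lt_of_lt_one_left exp_pos hc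
  refine ⟨?_, hlt⟩
  rw [← hD] at hlt ⊢
  rw [Valuation.map_sub_swap] at hlt
  exact Valuation.map_eq_of_sub_lt w hlt

variable {p : ℕ} [Fact p.Prime] {N : Type uK} [Field N] {M : Type uL} [Field M] [Algebra N M]
  [CharP M p] {u : Valuation N ℤᵐ⁰} {w : Valuation M ℤᵐ⁰} {t : M} {τ : N} {l : ℤ}

/-- Adjoining `t` with `t ^ p - t = τ` lets the term `ρ ^ p τ ^ j` be replaced, modulo the image of
the Artin–Schreier map, by `-j ρ ^ p t ^ (p (j - 1) + 1)` up to smaller terms. -/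
theorem val_sub_wp_mul_pow (hmap : ∀ a, w (algebraMap N M a) = u a ^ p) (hl0 : 0 < l)
    (hτ : u τ = exp l) (ht : wp p t = algebraMap N M τ) {ρ : N} {j : ℕ} {d : ℤ}
    (hρ : u (ρ ^ p * τ ^ j) = exp d) :
    w (algebraMap N M ρ * t ^ j) = exp d ∧
    w (algebraMap N M ρ ^ p * ((wp p t) ^ j - (t ^ p) ^ j)) ≤ exp (p * d - (p - 1) * l) ∧
    (¬ p ∣ j → w (algebraMap N M ρ ^ p * ((wp p t) ^ j - (t ^ p) ^ j)) =
      exp (p * d - (p - 1) * l)) := by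
  have hp : p.Prime := Fact.out
  have hp2 : (2 : ℤ) ≤ p := by exact_mod_cast hp.two_le
  have hwt : w t = exp l := by
    refine val_eq_of_val_wp (p := p) w hl0 ?_
    rw [ht, hmap, hτ, exp_pow_eq]
  have h1 : w (algebraMap N M ρ * t ^ j) = exp d := by
    refine eq_exp_of_pow_eq hp.ne_zero (n := p) ?_
    rw [← exp_pow_eq, ← hρ, map_mul, mul_pow, map_mul, mul_pow, hmap, map_pow, map_pow, map_pow,
      hwt, hτ]
  have h2 : w (algebraMap N M ρ ^ p) * w ((t ^ p) ^ j) = exp (p * d) := by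
    rw [← map_mul, ← pow_mul, mul_comm p j, pow_mul, ← mul_pow, map_pow, h1, exp_pow_eq]
  have hg : (exp (-((p - 1) * l)) : ℤᵐ⁰) < 1 := by
    rw [← exp_zero, exp_lt_exp]
    nlinarith
  have hu : w (-t) = exp (-((p - 1) * l)) * w (t ^ p) := by
    rw [Valuation.map_neg, map_pow, hwt, exp_pow_eq, ← exp_add]
    congr 1; ring
  have h3 : exp (p * d - (p - 1) * l) = w (algebraMap N M ρ ^ p) *
      (exp (-((p - 1) * l)) * w ((t ^ p) ^ j)) := by
    rw [mul_left_comm, h2, ← exp_add]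
    congr 1; ring
  refine ⟨h1, ?_, fun hj => ?_⟩
  · rw [map_mul, h3, wp, sub_eq_add_neg (t ^ p)]
    gcongr
    exact val_add_pow_sub_pow_le hg hu j
  · rw [map_mul, h3, wp, sub_eq_add_neg (t ^ p),
      val_add_pow_sub_pow_eq hg hu (val_natCast_eq_one w hj)]

/-- The version of the reduction step for arbitrary pole orders `≤ d`, by induction on `d`. -/
theorem exists_val_sub_wp_le (hu : Function.Surjective u) (hperf : ResiduallyPerfect p u)
    (hmap : ∀ a, w (algebraMap N M a) = u a ^ p) (hl0 : 0 < l) (hl : ¬ (p : ℤ) ∣ l)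
    (hτ : u τ = exp l) (ht : wp p t = algebraMap N M τ) (d : ℕ) {D : N} (hD : u D ≤ exp (d : ℤ)) :
    ∃ g : M, w (algebraMap N M D - wp p g) ≤ exp (max l (p * d - (p - 1) * l)) := by
  have hp : p.Prime := Fact.out
  have hp2 : (2 : ℤ) ≤ p := by exact_mod_cast hp.two_le
  induction d generalizing D with
  | zero =>
    refine ⟨0, ?_⟩
    have h1 : w (algebraMap N M D) ≤ 1 := by
      rw [hmap]
      exact pow_le_one' (by simpa using hD) p
    rw [wp, zero_pow hp.ne_zero, sub_zero, sub_zero]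
    refine h1.trans ?_
    rw [← exp_zero, exp_le_exp]
    exact le_max_of_le_left hl0.le
  | succ d ih =>
    have step : ∀ D' : N, u D' < exp ((d + 1 : ℕ) : ℤ) →
        ∃ g : M, w (algebraMap N M D' - wp p g) ≤ exp (max l (p * (d + 1 : ℕ) - (p - 1) * l)) := by
      intro D' hD'
      obtain ⟨g, hg⟩ := ih (D := D') (by
        rcases eq_or_ne D' 0 with rfl | h0
        · simp
        obtain ⟨m, hm⟩ := exists_eq_exp u h0
        rw [hm, exp_lt_exp] at hD'
        rw [hm, exp_le_exp]
        push_cast at hD'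
        omega)
      refine ⟨g, hg.trans ?_⟩
      rw [exp_le_exp]
      refine max_le_max le_rfl ?_
      push_cast
      nlinarith
    rcases hD.lt_or_eq with hlt | heq
    · exact step D hlt
    obtain ⟨j, ρ, -, hρ, hlt⟩ := exists_pow_mul_pow hu hperf hτ hl heq
    obtain ⟨g, hg⟩ := step _ hlt
    obtain ⟨h1, h2, -⟩ := val_sub_wp_mul_pow hmap hl0 hτ ht hρ
    refine ⟨g + algebraMap N M ρ * t ^ j, ?_⟩
    have : algebraMap N M D - wp p (g + algebraMap N M ρ * t ^ j) =
        (algebraMap N M (D - ρ ^ p * τ ^ j) - wp p g) +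
        (algebraMap N M ρ ^ p * ((wp p t) ^ j - (t ^ p) ^ j) + algebraMap N M ρ * t ^ j) := by
      rw [wp_add, ht, map_sub, map_mul, map_pow, map_pow, wp, wp]; ring
    rw [this]
    refine Valuation.map_add_le w hg (Valuation.map_add_le w ?_ ?_)
    · exact h2.trans (exp_le_exp.2 (le_max_right _ _))
    · rw [h1, exp_le_exp]
      rcases le_total ((d + 1 : ℕ) : ℤ) l with h | h
      · exact le_max_of_le_left h
      · refine le_max_of_le_right ?_
        nlinarith

/-- An Artin–Schreier constant `D` of pole order `d` prime to `p` acquires, over the extension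
generated by `t` with `t ^ p - t` of pole order `l < d`, a representative of pole order
`p d - (p - 1) l`. -/
theorem exists_val_sub_wp_eq (hu : Function.Surjective u) (hperf : ResiduallyPerfect p u)
    (hmap : ∀ a, w (algebraMap N M a) = u a ^ p) (hl0 : 0 < l) (hl : ¬ (p : ℤ) ∣ l)
    (hτ : u τ = exp l) (ht : wp p t = algebraMap N M τ) {d : ℤ} (hld : l < d)
    (hd : ¬ (p : ℤ) ∣ d) {D : N} (hD : u D = exp d) :
    ∃ g : M, w (algebraMap N M D - wp p g) = exp (p * d - (p - 1) * l) := by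
  have hp : p.Prime := Fact.out
  have hp2 : (2 : ℤ) ≤ p := by exact_mod_cast hp.two_le
  obtain ⟨j, ρ, hj, hρ, hlt⟩ := exists_pow_mul_pow hu hperf hτ hl hD
  obtain ⟨h1, -, h3⟩ := val_sub_wp_mul_pow hmap hl0 hτ ht hρ
  obtain ⟨g, hg⟩ := exists_val_sub_wp_le hu hperf hmap hl0 hl hτ ht (d - 1).toNat
    (D := D - ρ ^ p * τ ^ j) (by
      rcases eq_or_ne (D - ρ ^ p * τ ^ j) 0 with h0 | h0
      · simp [h0]
      obtain ⟨m, hm⟩ := exists_eq_exp u h0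
      rw [hm, exp_lt_exp] at hlt
      rw [hm, exp_le_exp, Int.toNat_of_nonneg (by omega)]
      omega)
  rw [Int.toNat_of_nonneg (by omega)] at hg
  refine ⟨g + algebraMap N M ρ * t ^ j, ?_⟩
  have : algebraMap N M D - wp p (g + algebraMap N M ρ * t ^ j) =
      algebraMap N M ρ ^ p * ((wp p t) ^ j - (t ^ p) ^ j) +
      ((algebraMap N M (D - ρ ^ p * τ ^ j) - wp p g) + algebraMap N M ρ * t ^ j) := by
    rw [wp_add, ht, map_sub, map_mul, map_pow, map_pow, wp, wp]; ring
  rw [this, Valuation.map_add_eq_of_lt_left w, h3 (hj hd)]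
  rw [h3 (hj hd)]
  refine Valuation.map_add_lt w (hg.trans_lt ?_) ?_
  · rw [exp_lt_exp, max_lt_iff]
    constructor <;> nlinarith
  · rw [h1, exp_lt_exp]
    nlinarith

end Reduction

/-! ### Artin–Schreier extensions of discretely valued fields -/

section Existence

theorem isDiscreteValuationRing_valuationSubring {K : Type uK} [Field K] {v : Valuation K ℤᵐ⁰}
    (hv : Function.Surjective v) : IsDiscreteValuationRing v.valuationSubring := by
  have : v.IsRankOneDiscrete := by
    refine ⟨⟨Units.mk0 (exp (-1 : ℤ)) exp_ne_zero, ?_, ?_⟩⟩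
    · ext y
      rw [Subgroup.mem_zpowers_iff, MonoidWithZeroHom.mem_valueGroup_iff_of_comm]
      constructor
      · intro _
        obtain ⟨x, hx⟩ := hv y
        exact ⟨1, by simp, x, by simp [hx]⟩
      · intro _
        refine ⟨-log (y : ℤᵐ⁰), Units.ext ?_⟩
        rw [Units.val_zpow_eq_zpow_val, Units.val_mk0, ← exp_zsmul]
        simp
    · rw [← Units.val_lt_val, Units.val_mk0, Units.val_one, ← exp_zero, exp_lt_exp]
      norm_num
  infer_instance

/-- Every normalized discrete valuation extends to a finite separable extension: localize the
integral closure of the valuation ring at a maximal ideal. -/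
theorem exists_extension {K : Type uK} [Field K] {v : Valuation K ℤᵐ⁰}
    (hv : Function.Surjective v) (L : Type uL) [Field L] [Algebra K L] [FiniteDimensional K L]
    [Algebra.IsSeparable K L] : ∃ w : Valuation L ℤᵐ⁰, IsNormalizedExtension v w := by
  have hdvr := isDiscreteValuationRing_valuationSubring hv
  let A := v.valuationSubring
  let B := integralClosure A L
  have : IsDedekindDomain B := integralClosure.isDedekindDomain A K L
  have : IsFractionRing B L := IsIntegralClosure.isFractionRing_of_finite_extension A K L B
  have hAB : Function.Injective (algebraMap A B) := fun a a' h =>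
    Subtype.ext ((algebraMap K L).injective (congrArg Subtype.val h))
  obtain ⟨P, hP⟩ := Ideal.exists_maximal B
  have hPA : P.comap (algebraMap A B) = IsLocalRing.maximalIdeal A :=
    IsLocalRing.eq_maximalIdeal (Ideal.isMaximal_comap_of_isIntegral_of_isMaximal P)
  obtain ⟨π, hπ⟩ := hv (exp (-1))
  have hπ1 : v π < 1 := by rw [hπ, ← exp_zero, exp_lt_exp]; norm_num
  have hmem : ∀ a : A, v a < 1 → algebraMap A B a ∈ P := by
    intro a ha
    rw [← Ideal.mem_comap, hPA]
    exact (Valuation.mem_maximalIdeal_iff K v).2 ha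
  have hP0 : P ≠ ⊥ := by
    rintro rfl
    have h1 := hmem ⟨π, hπ1.le⟩ hπ1
    rw [Ideal.mem_bot, map_eq_zero_iff _ hAB] at h1
    exact ne_zero_of_eq_exp hπ (congrArg Subtype.val h1)
  let P' : IsDedekindDomain.HeightOneSpectrum B := ⟨P, hP.isPrime, hP0⟩
  refine ⟨P'.valuation L, P'.valuation_surjective L, ?_⟩
  have hle : ∀ a : K, v a ≤ 1 → P'.valuation L (algebraMap K L a) ≤ 1 := fun a ha =>
    P'.valuation_le_one (K := L) (algebraMap A B ⟨a, ha⟩)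
  have hlt : ∀ a : K, v a < 1 → P'.valuation L (algebraMap K L a) < 1 := fun a ha =>
    (P'.valuation_lt_one_iff_mem (K := L) (algebraMap A B ⟨a, ha.le⟩)).2 (hmem ⟨a, ha.le⟩ ha)
  refine Valuation.isEquiv_of_val_le_one fun a => ⟨hle a, ?_⟩
  rw [Valuation.comap_apply]
  contrapose!
  intro h
  have h0 : a ≠ 0 := by rintro rfl; simp at h
  have h1 := hlt a⁻¹ (by rw [map_inv₀]; exact inv_lt_one_of_one_lt₀ h)
  rw [map_inv₀, map_inv₀] at h1
  exact (inv_lt_one₀ (by rw [Valuation.pos_iff]; simpa using h0)).1 h1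

end Existence

section Adjoin

variable (p : ℕ) [Fact p.Prime] {M : Type uL} [Field M] [CharP M p]

/-- Adjoining a root of `X ^ p - X - D`. -/
theorem exists_artinSchreier_extension (D : M) :
    ∃ (L : Type uL) (_ : Field L) (_ : Algebra M L) (z : L), wp p z = algebraMap M L D ∧
      FiniteDimensional M L ∧ Algebra.IsSeparable M L ∧ Module.finrank M L ≤ p := by
  have hp : p.Prime := Fact.out
  let f : Polynomial M := Polynomial.X ^ p - (Polynomial.X + Polynomial.C D)
  have hmonic : f.Monic := Polynomial.monic_X_pow_sub (by
    rw [Polynomial.degree_X_add_C]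
    exact_mod_cast hp.one_lt)
  have hnat : f.natDegree = p := by
    rw [Polynomial.natDegree_sub_eq_left_of_natDegree_lt, Polynomial.natDegree_X_pow]
    rw [Polynomial.natDegree_X_add_C, Polynomial.natDegree_X_pow]
    exact hp.one_lt
  have hsep : f.Separable := by
    rw [Polynomial.separable_def]
    have : Polynomial.derivative f = -1 := by
      simp [f, Polynomial.derivative_X_pow]
    rw [this]
    exact isCoprime_one_right.neg_right
  obtain ⟨z, hz⟩ := IsAlgClosed.exists_aeval_eq_zero (AlgebraicClosure M) f (by
    rw [Polynomial.degree_eq_natDegree hmonic.ne_zero, hnat]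
    exact_mod_cast hp.ne_zero)
  have hint : IsIntegral M z := ⟨f, hmonic, hz⟩
  have hdvd : minpoly M z ∣ f := minpoly.dvd M z hz
  refine ⟨IntermediateField.adjoin M {z}, inferInstance, inferInstance,
    IntermediateField.AdjoinSimple.gen M z, ?_, IntermediateField.adjoin.finiteDimensional hint,
    ?_, ?_⟩
  · refine Subtype.ext ?_
    simp [f] at hz
    simp [wp]
    linear_combination hz
  · exact (IntermediateField.isSeparable_adjoin_simple_iff_isSeparable M _).2 (hsep.of_dvd hdvd)
  · rw [IntermediateField.adjoin.finrank hint, ← hnat]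
    exact Polynomial.natDegree_le_of_dvd hdvd hmonic.ne_zero

variable {p} {L : Type*} [Field L] [Algebra M L]

/-- An Artin–Schreier extension whose constant has a pole of order `l` prime to `p` is totally
ramified of degree `p`. -/
theorem totallyRamified_of_wp [FiniteDimensional M L] {u : Valuation M ℤᵐ⁰}
    (hu : Function.Surjective u) (hdeg : Module.finrank M L ≤ p) {w : Valuation L ℤᵐ⁰}
    (hw : IsNormalizedExtension u w) {z : L} {D : M} {l : ℤ} (hl0 : 0 < l) (hl : ¬ (p : ℤ) ∣ l)
    (hD : u D = exp l) (hz : wp p z = algebraMap M L D) :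
    Module.finrank M L = p ∧ TotallyRamified u w ∧ w z = exp l := by
  have hp : p.Prime := Fact.out
  obtain ⟨e, he, hmap⟩ := exists_exponent hu hw.2
  have hle := (exponent_le_finrank hmap hw.1).trans hdeg
  have h1 : w (wp p z) = exp (e * l) := by rw [hz, hmap, hD, exp_pow_eq]
  have h2 : w z ^ p = exp (e * l) := by
    rw [val_pow_eq_val_wp w, h1]
    rw [h1, ← exp_zero, exp_lt_exp]
    positivity
  have hz0 : z ≠ 0 := by
    rintro rfl
    rw [map_zero, zero_pow hp.ne_zero] at h2
    exact exp_ne_zero h2.symm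
  obtain ⟨m, hm⟩ := exists_eq_exp w hz0
  rw [hm, exp_pow_eq, exp_inj] at h2
  have hpe : (p : ℤ) ∣ e := by
    refine (((Nat.prime_iff_prime_int.1 hp).coprime_iff_not_dvd.2 hl)).dvd_of_dvd_mul_right ?_
    exact ⟨m, h2.symm⟩
  have hpe' : e = p := le_antisymm hle (Nat.le_of_dvd he (Int.natCast_dvd_natCast.1 hpe))
  subst hpe'
  have hfin : Module.finrank M L = e := le_antisymm hdeg (exponent_le_finrank hmap hw.1)
  refine ⟨hfin, ⟨inferInstance, hw.1, by rwa [hfin]⟩, ?_⟩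
  rw [hm, exp_inj]
  exact mul_left_cancel₀ (by exact_mod_cast he.ne') h2

end Adjoin

/-! ### The reduced constant of the Heisenberg extension -/

section Leading

variable {L : Type uL} [Field L]

theorem val_natCast_le_one (w : Valuation L ℤᵐ⁰) (i : ℕ) : w (i : L) ≤ 1 := by
  induction i with
  | zero => simp
  | succ i ih => push_cast; exact Valuation.map_add_le w ih (by simp)

theorem exists_two_mul_one_add_pow {w : Valuation L ℤᵐ⁰} {ε : L} (hε : w ε < 1) (i : ℕ) :
    ∃ r, w r ≤ 1 ∧ 2 * (1 + ε) ^ i = 2 + 2 * i * ε + i * (i - 1) * ε ^ 2 + ε ^ 3 * r := by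
  induction i with
  | zero => exact ⟨0, by simp, by simp⟩
  | succ i ih =>
    obtain ⟨r, hr, h⟩ := ih
    refine ⟨i * (i - 1) + (1 + ε) * r, Valuation.map_add_le w ?_ ?_, ?_⟩
    · rw [map_mul]
      exact mul_le_one' (val_natCast_le_one w i)
        (Valuation.map_sub_le w (val_natCast_le_one w i) (by simp))
    · rw [map_mul]
      exact mul_le_one' (Valuation.map_add_le w (by simp) hε.le) hr
    · push_cast
      linear_combination (1 + ε) * h

/-- The constant `ω ^ p β ^ s (x + β / (s + 1))`, where `β = x ^ p - x`, has a pole of order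
`p k + p (s + 1) b` in which all terms down to order `p k + (p (s - 1) + 2) b` either cancel or form
a `p`-th power. -/
theorem val_heisenberg_constant {p : ℕ} [Fact p.Prime] [CharP L p] (hp2 : 2 < p)
    {w : Valuation L ℤᵐ⁰} {x ω κ : L} {b k : ℤ}
    (hb : 0 < b) (hx : w x = exp b) (hω : w ω = exp k) {s : ℕ} (hs : ¬ p ∣ s) (hκ : κ ^ p = κ)
    (hκs : κ * (s + 1) = 1) (hlt : k + (s + 1) * b < p * k + (p * (s - 1) + 2) * b) :
    w ((ω ^ p * wp p x ^ s * x + κ * (ω ^ p * wp p x ^ (s + 1))) - wp p (κ * ω * x ^ (s + 1))) =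
      exp (p * k + (p * (s - 1) + 2) * b) := by
  have hx0 := ne_zero_of_eq_exp hx
  have hκ0 : κ ≠ 0 := by rintro rfl; simp at hκs
  have hwκ : w κ = 1 := val_eq_one_of_wp_eq_zero (p := p) w (by rw [wp, hκ, sub_self]) hκ0
  have hw2 : w (2 : L) = 1 := by
    have := val_natCast_eq_one (p := p) w (i := 2) (Nat.not_dvd_of_pos_of_lt two_pos hp2)
    simpa using this
  set ε : L := -x / x ^ p with hε
  have hwε : w ε = exp ((1 - p) * b) := by
    rw [hε, map_div₀, Valuation.map_neg, map_pow, hx, exp_pow_eq, ← exp_sub]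
    congr 1; ring
  have hε0 : ε ≠ 0 := ne_zero_of_eq_exp hwε
  have hp2' : (2 : ℤ) < p := by exact_mod_cast hp2
  have hε1 : w ε < 1 := by
    rw [hwε, ← exp_zero, exp_lt_exp]
    nlinarith
  have hxε : x = -ε * x ^ p := by rw [hε]; field_simp
  have hβ : wp p x = x ^ p * (1 + ε) := by
    rw [wp]; linear_combination -hxε
  obtain ⟨r₁, hr₁, h₁⟩ := exists_two_mul_one_add_pow hε1 s
  obtain ⟨r₂, hr₂, h₂⟩ := exists_two_mul_one_add_pow hε1 (s + 1)
  set B : L := -(1 + ε) ^ s * ε + κ * (1 + ε) ^ (s + 1) - κ with hB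
  have hB2 : 2 * B = -s * ε ^ 2 + ε ^ 3 * (κ * r₂ - s * (s - 1) - ε * r₁) := by
    rw [hB]
    push_cast at h₂
    linear_combination (-ε) * h₁ + κ * h₂ + (2 * ε + s * ε ^ 2) * hκs
  have hwB : w B = exp (2 * (1 - p) * b) := by
    have h3 : w (2 * B) = w (-s * ε ^ 2 : L) := by
      rw [hB2, Valuation.map_add_eq_of_lt_left w]
      rw [map_mul, map_mul, Valuation.map_neg, val_natCast_eq_one w hs, one_mul, map_pow, map_pow]
      have h4 : w (κ * r₂ - s * (s - 1) - ε * r₁) ≤ 1 := by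
        refine Valuation.map_sub_le w (Valuation.map_sub_le w ?_ ?_) ?_
        · rw [map_mul, hwκ, one_mul]; exact hr₂
        · rw [map_mul]
          exact mul_le_one' (val_natCast_le_one w s)
            (Valuation.map_sub_le w (val_natCast_le_one w s) (by simp))
        · rw [map_mul]; exact mul_le_one' hε1.le hr₁
      calc w ε ^ 3 * _ ≤ w ε ^ 3 * 1 := by gcongr
        _ < w ε ^ 2 := by
          rw [mul_one, hwε, exp_pow_eq, exp_pow_eq, exp_lt_exp]
          push_cast
          nlinarith
    rw [map_mul, hw2, one_mul, map_mul, Valuation.map_neg, val_natCast_eq_one w hs, one_mul,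
      map_pow, hwε, exp_pow_eq] at h3
    rw [h3]
    congr 1; push_cast; ring
  have hsum : (ω ^ p * wp p x ^ s * x + κ * (ω ^ p * wp p x ^ (s + 1))) -
      wp p (κ * ω * x ^ (s + 1)) = ω ^ p * (x ^ p) ^ (s + 1) * B + κ * ω * x ^ (s + 1) := by
    have h5 : (x ^ (s + 1)) ^ p = (x ^ p) ^ (s + 1) := by rw [← pow_mul, ← pow_mul, mul_comm]
    have h6 : wp p (κ * ω * x ^ (s + 1)) =
        κ * ω ^ p * (x ^ p) ^ (s + 1) - κ * ω * x ^ (s + 1) := by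
      rw [wp, mul_pow _ (x ^ (s + 1)), mul_pow κ, hκ, h5]
    rw [h6, hβ, hB, mul_pow, mul_pow]
    linear_combination (ω ^ p * (x ^ p) ^ s * (1 + ε) ^ s) * hxε
  have hmain : w (ω ^ p * (x ^ p) ^ (s + 1) * B) = exp (p * k + (p * (s - 1) + 2) * b) := by
    rw [map_mul, map_mul, map_pow, map_pow, map_pow, hω, hx, hwB, exp_pow_eq, exp_pow_eq,
      exp_pow_eq, ← exp_add, ← exp_add]
    congr 1; push_cast; ring
  rw [hsum, Valuation.map_add_eq_of_lt_left w, hmain]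
  rw [hmain, map_mul, map_mul, map_pow, hwκ, one_mul, hω, hx, exp_pow_eq, ← exp_add, exp_lt_exp]
  push_cast
  linarith

end Leading

/-! ### Generators of ramified extensions of degree `p` -/

section Residue

/-- An element `ξ` with `ξ ^ p - ξ` in the base field has degree `1` or `p`: a proper factor of
`∏ (X - ξ - i)` of degree `d` has second coefficient `-(d ξ + j)` with `j` in the prime field. -/
theorem mem_range_or_natDegree_minpoly_eq {p : ℕ} [Fact p.Prime] {k k' : Type*} [Field k]
    [Field k'] [Algebra k k'] [CharP k p] {ξ : k'} {β : k} (h : wp p ξ = algebraMap k k' β) :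
    (∃ c, algebraMap k k' c = ξ) ∨ p ≤ (minpoly k ξ).natDegree := by
  have hp : p.Prime := Fact.out
  have : CharP k' p := charP_of_injective_algebraMap (algebraMap k k').injective p
  rw [or_iff_not_imp_right, not_le]
  intro hlt
  let f : Polynomial k := Polynomial.X ^ p - (Polynomial.X + Polynomial.C β)
  have hmonic : f.Monic := Polynomial.monic_X_pow_sub (by
    rw [Polynomial.degree_X_add_C]
    exact_mod_cast hp.one_lt)
  have hroot : Polynomial.aeval ξ f = 0 := by
    rw [wp] at h
    simp only [f, map_sub, map_pow, map_add, Polynomial.aeval_X, Polynomial.aeval_C]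
    linear_combination h
  have hint : IsIntegral k ξ := ⟨f, hmonic, hroot⟩
  let Ω := AlgebraicClosure k'
  have : CharP Ω p := charP_of_injective_algebraMap (algebraMap k' Ω).injective p
  set q := (minpoly k ξ).map (algebraMap k Ω) with hq
  have hqm : q.Monic := (minpoly.monic hint).map _
  have hsp : q.Splits := IsAlgClosed.splits q
  have hroots : ∀ r ∈ q.roots, ∃ i : ZMod p, r = algebraMap k' Ω ξ +
      ZMod.castHom (dvd_refl p) Ω i := by
    intro r hr
    have h1 : Polynomial.aeval r (minpoly k ξ) = 0 := by
      have := (Polynomial.mem_roots hqm.ne_zero).1 hr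
      rwa [Polynomial.IsRoot, hq, Polynomial.eval_map_algebraMap] at this
    have h2 : Polynomial.aeval r f = 0 := by
      obtain ⟨g, hg⟩ := minpoly.dvd k ξ hroot
      rw [hg, map_mul, h1, zero_mul]
    have h3 : wp p (r - algebraMap k' Ω ξ) = 0 := by
      rw [wp_sub, ← map_wp, h, ← IsScalarTower.algebraMap_apply, wp]
      simp only [f, map_sub, map_pow, map_add, Polynomial.aeval_X, Polynomial.aeval_C] at h2
      linear_combination h2
    obtain ⟨i, hi⟩ := exists_cast_of_wp_eq_zero p h3
    exact ⟨i, by rw [hi]; ring⟩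
  have hsum : ∀ s : Multiset Ω, (∀ r ∈ s, ∃ i : ZMod p, r = algebraMap k' Ω ξ +
      ZMod.castHom (dvd_refl p) Ω i) → ∃ i : ZMod p, s.sum = s.card * algebraMap k' Ω ξ +
      ZMod.castHom (dvd_refl p) Ω i := by
    intro s
    induction s using Multiset.induction_on with
    | empty => exact fun _ => ⟨0, by simp⟩
    | cons r s ih =>
      intro hs
      obtain ⟨i, hi⟩ := ih fun r hr => hs r (Multiset.mem_cons_of_mem hr)
      obtain ⟨j, hj⟩ := hs r (Multiset.mem_cons_self r s)
      refine ⟨i + j, ?_⟩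
      rw [Multiset.sum_cons, Multiset.card_cons, hi, hj, map_add]
      push_cast
      ring
  obtain ⟨i, hi⟩ := hsum q.roots hroots
  have hcard : q.roots.card = (minpoly k ξ).natDegree := by
    rw [← hsp.natDegree_eq_card_roots, hq, Polynomial.natDegree_map]
  set d := (minpoly k ξ).natDegree with hd
  have hd0 : (d : k) ≠ 0 := by
    rw [Ne, CharP.cast_eq_zero_iff k p]
    exact Nat.not_dvd_of_pos_of_lt (minpoly.natDegree_pos hint) hlt
  have hnext := hsp.nextCoeff_eq_neg_sum_roots_of_monic hqm
  rw [hi, hcard, hq, Polynomial.nextCoeff_map (algebraMap k Ω).injective] at hnext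
  refine ⟨(-(minpoly k ξ).nextCoeff - ZMod.castHom (dvd_refl p) k i) / d, ?_⟩
  apply (algebraMap k' Ω).injective
  have hc : algebraMap k Ω (ZMod.castHom (dvd_refl p) k i) = ZMod.castHom (dvd_refl p) Ω i := by
    rw [← RingHom.comp_apply]
    congr 1
    exact Subsingleton.elim _ _
  have hd0' : (d : Ω) ≠ 0 := by
    rwa [Ne, CharP.cast_eq_zero_iff Ω p, ← CharP.cast_eq_zero_iff k p]
  rw [← IsScalarTower.algebraMap_apply, map_div₀, map_sub, map_neg, map_natCast, hc, hnext,
    div_eq_iff hd0']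
  ring

end Residue

section Unramified

variable {p : ℕ} [Fact p.Prime] {K : Type uK} [Field K] [CharP K p] {F : Type uL} [Field F]
  [Algebra K F] {v : Valuation K ℤᵐ⁰} {w : Valuation F ℤᵐ⁰}

/-- If `x ^ p - x = β` with `β` integral, and `β` is not congruent to a value of the Artin–Schreier
map, then `K(x)` is unramified over `K`, as `1, x, …, x ^ (p - 1)` are independent over the residue
field. -/
theorem exponent_eq_one_of_integral [FiniteDimensional K F] (hdeg : Module.finrank K F = p)
    (hw : Function.Surjective w) (heq : v.IsEquiv (w.comap (algebraMap K F))) {e : ℕ}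
    (he : ∀ a, w (algebraMap K F a) = v a ^ e) {x : F} {β : K}
    (hx : wp p x = algebraMap K F β) (hβ : v β ≤ 1)
    (hno : ∀ c : K, v c ≤ 1 → ¬ v (β - wp p c) < 1) : e = 1 := by
  have hp : p.Prime := Fact.out
  have hext : v.HasExtension w := ⟨heq⟩
  have hwx : w x ≤ 1 := by
    by_contra! hgt
    have h3 : w (wp p x) ≤ 1 := by
      rw [hx, he]; exact pow_le_one' hβ e
    rw [val_wp_of_one_lt w hgt] at h3
    exact absurd h3 (not_le.2 (one_lt_pow₀ hgt hp.ne_zero))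
  let O := v.valuationSubring
  let O' := w.valuationSubring
  let k := IsLocalRing.ResidueField O
  let k' := IsLocalRing.ResidueField O'
  let X : O' := ⟨x, hwx⟩
  let ξ : k' := IsLocalRing.residue O' X
  have : CharP k p := by
    have h0 : (p : O) = 0 := Subtype.ext (by simp)
    have h1 : (p : k) = 0 := by
      rw [← map_natCast (IsLocalRing.residue O), h0, map_zero]
    exact (CharP.charP_iff_prime_eq_zero Fact.out).2 h1
  have hX : X ^ p - X = algebraMap O O' ⟨β, hβ⟩ := Subtype.ext hx
  have hξ : wp p ξ = algebraMap k k' (IsLocalRing.residue O ⟨β, hβ⟩) := by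
    rw [Valuation.HasExtension.algebraMap_residue_eq_residue_algebraMap]
    rw [← hX, map_sub, map_pow, wp]
  have hpdeg : p ≤ (minpoly k ξ).natDegree := by
    refine (mem_range_or_natDegree_minpoly_eq hξ).resolve_left ?_
    rintro ⟨c, hc⟩
    obtain ⟨c, rfl⟩ := IsLocalRing.residue_surjective c
    refine hno c c.2 ?_
    have h1 : IsLocalRing.residue O (⟨β, hβ⟩ - (c ^ p - c)) = 0 := by
      apply (algebraMap k k').injective
      rw [map_sub, map_sub, ← hξ, ← hc, map_zero, wp, map_sub, map_pow, map_sub, map_pow]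
      ring
    rw [IsLocalRing.residue_eq_zero_iff] at h1
    exact (Valuation.mem_maximalIdeal_iff K v).1 h1
  have hli := linearIndependent_pow (K := k) ξ
  have key : ∀ a : Fin p → K, a ≠ 0 → ∃ c : K, w (∑ i, algebraMap K F (a i) * x ^ (i : ℕ)) =
      w (algebraMap K F c) ∧ c ≠ 0 := by
    intro a ha
    have : Nonempty (Fin p) := ⟨⟨0, hp.pos⟩⟩
    obtain ⟨i₀, hi₀⟩ := Finite.exists_max fun i => v (a i)
    have ha0 : a i₀ ≠ 0 := by
      intro h0
      apply ha
      ext i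
      have := hi₀ i
      rw [h0, map_zero] at this
      simpa using le_antisymm this zero_le
    refine ⟨a i₀, ?_, ha0⟩
    have hb : ∀ i, v (a i / a i₀) ≤ 1 := by
      intro i
      rw [map_div₀]
      exact div_le_one_of_le₀ (hi₀ i) zero_le
    let y : O' := ∑ i : Fin p, algebraMap O O' ⟨a i / a i₀, hb i⟩ * X ^ (i : ℕ)
    have hy : w y = 1 := by
      refine le_antisymm y.2 (not_lt.1 fun hlt => ?_)
      have h1 : IsLocalRing.residue O' y = 0 := by
        rw [IsLocalRing.residue_eq_zero_iff]
        exact (Valuation.mem_maximalIdeal_iff F w).2 hlt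
      have h2 : ∑ i : Fin p, IsLocalRing.residue O ⟨a i / a i₀, hb i⟩ • ξ ^ (i : ℕ) = 0 := by
        rw [← h1, map_sum]
        refine Finset.sum_congr rfl fun i _ => ?_
        rw [Algebra.smul_def, map_mul, map_pow,
          Valuation.HasExtension.algebraMap_residue_eq_residue_algebraMap]
      have hli' := hli.comp (Fin.castLE hpdeg) (Fin.castLE_injective hpdeg)
      have h3 := Fintype.linearIndependent_iff.1 hli' _ h2 i₀
      rw [IsLocalRing.residue_eq_zero_iff] at h3
      have h4 := (Valuation.mem_maximalIdeal_iff K v).1 h3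
      simp [ha0] at h4
    have h5 : ∑ i, algebraMap K F (a i) * x ^ (i : ℕ) = algebraMap K F (a i₀) * y := by
      have h6 : (y : F) = ∑ i : Fin p, algebraMap K F (a i / a i₀) * x ^ (i : ℕ) :=
        (map_sum O'.subtype _ _).trans
          (Finset.sum_congr rfl fun i _ => by rw [map_mul, map_pow]; rfl)
      rw [h6, Finset.mul_sum]
      refine Finset.sum_congr rfl fun i _ => ?_
      rw [← mul_assoc, ← map_mul, mul_div_cancel₀ _ ha0]
    rw [h5, map_mul, hy, mul_one]
  have hliK : LinearIndependent K fun i : Fin p => x ^ (i : ℕ) := by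
    rw [Fintype.linearIndependent_iff]
    intro a ha
    by_contra! hne
    obtain ⟨i, hi⟩ := hne
    obtain ⟨c, hc, hc0⟩ := key a (by rintro rfl; simp at hi)
    simp only [Algebra.smul_def] at ha
    rw [ha, map_zero] at hc
    have := (Valuation.zero_iff w).1 hc.symm
    exact hc0 (by simpa using this)
  have : Nonempty (Fin p) := ⟨⟨0, hp.pos⟩⟩
  have hspan := hliK.span_eq_top_of_card_eq_finrank (by simp [hdeg])
  obtain ⟨y, hy⟩ := hw (exp 1)
  obtain ⟨a, ha⟩ := (Submodule.mem_span_range_iff_exists_fun K).1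
    (show y ∈ Submodule.span K _ from hspan ▸ Submodule.mem_top)
  simp only [Algebra.smul_def] at ha
  obtain ⟨c, hc, hc0⟩ := key a (by
    rintro rfl
    simp at ha
    exact ne_zero_of_eq_exp hy ha.symm)
  obtain ⟨m, hm⟩ := exists_eq_exp v hc0
  rw [ha, hy, he, hm, exp_pow_eq, exp_inj] at hc
  have h7 := Int.natAbs_dvd_natAbs.2 (⟨m, hc⟩ : (e : ℤ) ∣ 1)
  simpa using h7

end Unramified

section Complete

theorem nonarchimedeanAddGroup_of_valued (K : Type uK) [Field K] [Valued K ℤᵐ⁰] :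
    NonarchimedeanAddGroup K where
  is_nonarchimedean U hU := by
    obtain ⟨γ, hγ⟩ := Valued.mem_nhds_zero.1 hU
    exact ⟨⟨(Valued.v : Valuation K ℤᵐ⁰).restrict.ltAddSubgroup γ, Valued.isOpen_ball K γ.1⟩, hγ⟩

/-- Over a complete field, `X ^ p - X - γ` has a root as soon as `γ` has value less than `1`. -/
theorem exists_wp_eq {p : ℕ} [Fact p.Prime] {K : Type uK} [Field K] [CharP K p] [Valued K ℤᵐ⁰]
    [CompleteSpace K] {γ : K} (hγ : Valued.v γ < (1 : ℤᵐ⁰)) : ∃ T : K, wp p T = γ := by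
  have hp : p.Prime := Fact.out
  have hpow : Filter.Tendsto (fun n : ℕ => γ ^ p ^ n) Filter.atTop (nhds 0) :=
    (Valued.tendsto_zero_pow_of_v_lt_one hγ).comp
      (tendsto_pow_atTop_atTop_of_one_lt hp.one_lt)
  have := nonarchimedeanAddGroup_of_valued K
  have hsum : Summable fun n : ℕ => γ ^ p ^ n :=
    NonarchimedeanAddGroup.summable_of_tendsto_cofinite_zero (by rwa [Nat.cofinite_eq_atTop])
  obtain ⟨S, hS⟩ := hsum
  have hlim := hS.tendsto_sum_nat
  have hwp : ∀ n, wp p (-∑ i ∈ Finset.range n, γ ^ p ^ i) = γ - γ ^ p ^ n := by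
    intro n
    induction n with
    | zero => simp [wp, hp.ne_zero]
    | succ n ih =>
      rw [Finset.sum_range_succ, neg_add, ← sub_eq_add_neg, wp_sub, ih, wp, ← pow_mul, ← pow_succ]
      ring
  refine ⟨-S, tendsto_nhds_unique (f := fun n => wp p (-∑ i ∈ Finset.range n, γ ^ p ^ i))
    (l := Filter.atTop) ?_ ?_⟩
  · have hc : Continuous fun y : K => wp p (-y) := by
      unfold wp; fun_prop
    exact (hc.tendsto S).comp hlim
  · simp only [hwp]
    simpa using hpow.const_sub γ

end Complete

section Cyclic

variable {p : ℕ} [Fact p.Prime] {K : Type uK} [Field K] [CharP K p] {F : Type uL} [Field F]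
  [Algebra K F]

/-- A cyclic extension of degree `p` in characteristic `p` has an Artin–Schreier generator: since
`N = σ - 1` is nilpotent, some `y` satisfies `N y ≠ 0 = N (N y)`, and `x = y / N y` has
`σ x = x + 1`. -/
theorem exists_map_eq_add_one [FiniteDimensional K F] [IsGalois K F]
    (hF : Nonempty ((F ≃ₐ[K] F) ≃* Multiplicative (ZMod p))) :
    Module.finrank K F = p ∧ ∃ (σ : F ≃ₐ[K] F) (x : F), σ x = x + 1 ∧
      ∀ z : F, σ z = z → ∃ a, algebraMap K F a = z := by
  have hp : p.Prime := Fact.out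
  obtain ⟨f⟩ := hF
  have hcard : Nat.card (F ≃ₐ[K] F) = p := by
    rw [Nat.card_congr f.toEquiv]
    simp
  refine ⟨by rw [← IsGalois.card_aut_eq_finrank, hcard], ?_⟩
  set σ : F ≃ₐ[K] F := f.symm (Multiplicative.ofAdd 1) with hσ
  have hgen : ∀ τ : F ≃ₐ[K] F, ∃ i : ℕ, τ = σ ^ i := by
    intro τ
    refine ⟨(Multiplicative.toAdd (f τ)).val, ?_⟩
    apply f.injective
    rw [hσ, map_pow, MulEquiv.apply_symm_apply, ← ofAdd_nsmul]
    simp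
  have hfix : ∀ z : F, σ z = z → ∃ a, algebraMap K F a = z := by
    intro z hz
    refine (IsGalois.mem_range_algebraMap_iff_fixed z).2 fun τ => ?_
    obtain ⟨i, rfl⟩ := hgen τ
    induction i with
    | zero => simp
    | succ i ih => rw [pow_succ, AlgEquiv.mul_apply, hz, ih]
  let s : Module.End K F := σ.toLinearMap
  let N : Module.End K F := s - 1
  have hNapp : ∀ z, N z = σ z - z := fun z => rfl
  have hspow : ∀ (i : ℕ) (z : F), (s ^ i) z = (σ ^ i) z := by
    intro i
    induction i with
    | zero => simp
    | succ i ih => intro z; rw [pow_succ, pow_succ, Module.End.mul_apply, ih]; rfl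
  have hσp : σ ^ p = 1 := by rw [← hcard]; exact pow_card_eq_one'
  have : CharP (Module.End K F) p :=
    charP_of_injective_algebraMap (algebraMap K (Module.End K F)).injective p
  have hNp : N ^ p = 0 := by
    rw [sub_pow_char_of_commute p (Commute.one_right s), one_pow, sub_eq_zero]
    ext z
    rw [hspow, hσp]
    rfl
  have hN0 : N ≠ 0 := by
    intro h0
    have h1 : σ = 1 := by
      ext z
      have := LinearMap.congr_fun h0 z
      rw [hNapp] at this
      exact sub_eq_zero.1 this
    have h2 : Multiplicative.ofAdd (1 : ZMod p) = 1 := by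
      rw [← f.symm.map_eq_one_iff, ← hσ, h1]
    have h3 : (1 : ZMod p) = 0 := Multiplicative.ofAdd.injective h2
    have : Fact (1 < p) := ⟨hp.one_lt⟩
    exact one_ne_zero h3
  classical
  have hex : ∃ k, N ^ k = 0 := ⟨p, hNp⟩
  obtain ⟨k, hk⟩ : ∃ k, Nat.find hex = k + 2 := by
    have h0 : Nat.find hex ≠ 0 := by
      intro h
      have := Nat.find_spec hex
      rw [h, pow_zero] at this
      exact one_ne_zero this
    have h1 : Nat.find hex ≠ 1 := by
      intro h
      have := Nat.find_spec hex
      rw [h, pow_one] at this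
      exact hN0 this
    exact ⟨Nat.find hex - 2, by omega⟩
  have hne : N ^ (k + 1) ≠ 0 := Nat.find_min hex (by omega)
  obtain ⟨t, ht⟩ : ∃ t, (N ^ (k + 1)) t ≠ 0 := by
    by_contra! h
    exact hne (LinearMap.ext h)
  have hN2 : N (N ((N ^ k) t)) = 0 := by
    have h1 := LinearMap.congr_fun (Nat.find_spec hex) t
    rw [hk, pow_succ', pow_succ'] at h1
    exact h1
  rw [pow_succ', Module.End.mul_apply] at ht
  set y := (N ^ k) t
  have hσN : σ (N y) = N y := by rw [hNapp (N y), sub_eq_zero] at hN2; exact hN2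
  have hσy : σ y = y + N y := by rw [hNapp]; ring
  refine ⟨σ, y / N y, ?_, hfix⟩
  rw [map_div₀, hσN, hσy, add_div, div_self ht]

end Cyclic

section Ramified

variable {p : ℕ} [Fact p.Prime] {K : Type uK} [Field K] {F : Type uL} [Field F]
  [Algebra K F]

theorem exists_natCast_eq_exp {v : Valuation K ℤᵐ⁰} (β : K) (h : ¬ v β ≤ 1) :
    ∃ d : ℕ, 0 < d ∧ v β = exp (d : ℤ) := by
  obtain ⟨m, hm⟩ := exists_eq_exp v (x := β) (by rintro rfl; simp at h)
  rw [hm, ← exp_zero, exp_le_exp, not_le] at h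
  exact ⟨m.toNat, by omega, by rw [hm, Int.toNat_of_nonneg h.le]⟩

/-- An Artin–Schreier generator can be chosen so that its constant is integral or has a pole of
order prime to `p`: a leading term of order divisible by `p` is a `p`-th power and can be
lowered. -/
theorem exists_reduced_generator [CharP F p] {v : Valuation K ℤᵐ⁰} (hv : Function.Surjective v)
    (hperf : ResiduallyPerfect p v) {x : F} {β : K} (hx : wp p x = algebraMap K F β) :
    ∃ (c β' : K), wp p (x - algebraMap K F c) = algebraMap K F β' ∧
      (v β' ≤ 1 ∨ ∃ d : ℕ, 0 < d ∧ ¬ p ∣ d ∧ v β' = exp (d : ℤ)) := by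
  have hp : p.Prime := Fact.out
  have main : ∀ (n : ℕ) (x : F) (β : K), wp p x = algebraMap K F β → v β ≤ exp (n : ℤ) →
      ∃ (c β' : K), wp p (x - algebraMap K F c) = algebraMap K F β' ∧
      (v β' ≤ 1 ∨ ∃ d : ℕ, 0 < d ∧ ¬ p ∣ d ∧ v β' = exp (d : ℤ)) := by
    intro n
    induction n with
    | zero => exact fun x β hx hβ => ⟨0, β, by simpa using hx, Or.inl (by simpa using hβ)⟩
    | succ n ih =>
      intro x β hx hβ
      by_cases h1 : v β ≤ 1
      · exact ⟨0, β, by simpa using hx, Or.inl h1⟩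
      obtain ⟨d, hd0, hd⟩ := exists_natCast_eq_exp β h1
      by_cases hpd : p ∣ d
      · obtain ⟨e, rfl⟩ := hpd
        have he0 : 0 < e := Nat.pos_of_mul_pos_left hd0
        obtain ⟨ρ, hρ⟩ := hv (exp (e : ℤ))
        have hρ0 := ne_zero_of_eq_exp hρ
        have hρp : v (ρ ^ p) = v β := by rw [map_pow, hρ, exp_pow_eq, hd]; push_cast; rfl
        obtain ⟨c, hc⟩ := hperf (β / ρ ^ p) (by
          rw [map_div₀, hρp, hd, div_self exp_ne_zero])
        have hlt : v (β - (c * ρ) ^ p) < exp ((n + 1 : ℕ) : ℤ) := by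
          have : β - (c * ρ) ^ p = (β / ρ ^ p - c ^ p) * ρ ^ p := by
            rw [sub_mul, div_mul_cancel₀ _ (pow_ne_zero _ hρ0)]; ring
          rw [this, map_mul, hρp]
          exact lt_of_lt_of_le (mul_lt_of_lt_one_left (by rw [hd]; exact exp_pos) hc) hβ
        have hc1 : v c ≤ 1 := by
          have h2 : v (c ^ p) ≤ 1 := by
            have h3 : c ^ p = β / ρ ^ p - (β / ρ ^ p - c ^ p) := by ring
            rw [h3]
            refine Valuation.map_sub_le v ?_ hc.le
            rw [map_div₀, hρp, hd, div_self exp_ne_zero]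
          rw [map_pow] at h2
          exact (pow_le_one_iff_of_nonneg zero_le hp.ne_zero).1 h2
        rw [hd, exp_le_exp] at hβ
        have hen : (e : ℤ) ≤ n := by
          have := hp.two_le
          have h4 : p * e ≤ n + 1 := by exact_mod_cast hβ
          have h5 : 2 * e ≤ p * e := by gcongr
          omega
        obtain ⟨c', β', h5, h6⟩ := ih (x - algebraMap K F (c * ρ)) (β - (c * ρ) ^ p + c * ρ) (by
            rw [wp_sub, hx, wp, map_add, map_sub, map_pow]; ring) (by
          refine Valuation.map_add_le v ?_ ?_
          · rcases eq_or_ne (β - (c * ρ) ^ p) 0 with h0 | h0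
            · simp [h0]
            obtain ⟨m, hm⟩ := exists_eq_exp v h0
            rw [hm, exp_lt_exp] at hlt
            rw [hm, exp_le_exp]
            push_cast at hlt
            omega
          · rw [map_mul, hρ]
            exact (mul_le_of_le_one_left' hc1).trans (exp_le_exp.2 hen))
        refine ⟨c * ρ + c', β', ?_, h6⟩
        rw [← h5, map_add, sub_sub]
      · exact ⟨0, β, by simpa using hx, Or.inr ⟨d, hd0, hpd, hd⟩⟩
  by_cases h1 : v β ≤ 1
  · exact ⟨0, β, by simpa using hx, Or.inl h1⟩
  obtain ⟨d, -, hd⟩ := exists_natCast_eq_exp β h1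
  exact main d x β hx hd.le

end Ramified

/-- A ramified cyclic extension of degree `p` of a complete field with perfect residue field is
generated by a root of `X ^ p - X - β`, where `β` has a pole of order prime to `p`. -/
theorem exists_ramified_generator {p : ℕ} [Fact p.Prime] {K : Type uK} [Field K] [CharP K p]
    [Valued K ℤᵐ⁰] (hK : Function.Surjective (Valued.v : Valuation K ℤᵐ⁰)) [CompleteSpace K]
    (hperf : ResiduallyPerfect p (Valued.v : Valuation K ℤᵐ⁰))
    {F : Type uL} [Field F] [Algebra K F] [FiniteDimensional K F] [IsGalois K F]
    (hF : Nonempty ((F ≃ₐ[K] F) ≃* Multiplicative (ZMod p))) {w : Valuation F ℤᵐ⁰}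
    (hw : IsNormalizedExtension (Valued.v : Valuation K ℤᵐ⁰) w)
    (hram : ∀ π : K, Valued.v π = (exp (-1) : ℤᵐ⁰) → w (algebraMap K F π) ≠ exp (-1)) :
    Module.finrank K F = p ∧ ∃ (x : F) (β : K) (d : ℕ), wp p x = algebraMap K F β ∧ 0 < d ∧
      ¬ p ∣ d ∧ Valued.v β = (exp (d : ℤ) : ℤᵐ⁰) := by
  have : CharP F p := charP_of_injective_algebraMap (algebraMap K F).injective p
  obtain ⟨hdeg, σ, x₀, hσx₀, hfix⟩ := exists_map_eq_add_one (p := p) hF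
  obtain ⟨β₀, hβ₀⟩ := hfix (wp p x₀) (by
    rw [map_wp, hσx₀, wp_add]
    simp [wp])
  obtain ⟨c, β, hx, hβ⟩ := exists_reduced_generator hK hperf hβ₀.symm
  set x := x₀ - algebraMap K F c with hxdef
  have hσx : σ x = x + 1 := by rw [hxdef, map_sub, hσx₀, AlgEquiv.commutes]; ring
  refine ⟨hdeg, x, β, ?_⟩
  rcases hβ with hβ | ⟨d, hd0, hpd, hd⟩
  · exfalso
    obtain ⟨e, he0, he⟩ := exists_exponent hK hw.2
    have he1 : e ≠ 1 := by
      rintro rfl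
      obtain ⟨π, hπ⟩ := hK (exp (-1))
      exact hram π hπ (by rw [he, hπ, pow_one])
    apply he1
    refine exponent_eq_one_of_integral (p := p) hdeg hw.1 hw.2 he hx hβ fun c' _ hlt => ?_
    obtain ⟨T, hT⟩ := exists_wp_eq (p := p) hlt
    have h0 : wp p (x - algebraMap K F (c' + T)) = 0 := by
      rw [wp_sub, hx, ← map_wp, wp_add, hT]
      simp
    obtain ⟨i, hi⟩ := exists_cast_of_wp_eq_zero p h0
    have h1 : σ (x - algebraMap K F (c' + T)) = x - algebraMap K F (c' + T) := by
      rw [← hi, ← RingHom.coe_coe σ, ← RingHom.comp_apply]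
      congr 1
      exact Subsingleton.elim _ _
    rw [map_sub, hσx, AlgEquiv.commutes] at h1
    have h2 : (1 : F) = 0 := by linear_combination h1
    exact one_ne_zero h2
  · exact ⟨d, hx, hd0, hpd, hd⟩

/-! ### The Galois group of the Heisenberg extension -/

section Galois

/-- An extension that every embedding into an algebraic closure maps into itself is normal. -/
theorem normal_of_forall_mem_range {K : Type uK} [Field K] {L : Type uL} [Field L] [Algebra K L]
    [Algebra.IsAlgebraic K L]
    (h : ∀ (φ : L →ₐ[K] AlgebraicClosure L) (a : L),
      ∃ b, algebraMap L (AlgebraicClosure L) b = φ a) :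
    Normal K L := by
  have : Algebra.IsAlgebraic K (AlgebraicClosure L) := Algebra.IsAlgebraic.trans K L _
  have : IsAlgClosure K (AlgebraicClosure L) := ⟨inferInstance, inferInstance⟩
  have : Normal K (AlgebraicClosure L) := IsAlgClosure.normal K _
  let ψ := IsScalarTower.toAlgHom K L (AlgebraicClosure L)
  have hn : Normal K ψ.fieldRange := by
    rw [IntermediateField.normal_iff_forall_map_le]
    rintro σ - ⟨-, ⟨a, rfl⟩, rfl⟩
    obtain ⟨b, hb⟩ := h (σ.comp ψ) a
    exact ⟨b, hb⟩
  have e : L ≃ₐ[K] ψ.fieldRange := AlgEquiv.ofInjectiveField ψ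
  exact Normal.of_algEquiv e.symm

/-- A totally ramified extension is generated, as a ring over the base, by any element whose value
is prime to the degree. -/
theorem TotallyRamified.mem_subring {K : Type uK} [Field K] {L : Type uL} [Field L] [Algebra K L]
    {v : Valuation K ℤᵐ⁰} {w : Valuation L ℤᵐ⁰} (h : TotallyRamified v w) {y : L} {m : ℤ}
    (hy : w y = exp m) (hm : IsCoprime m (Module.finrank K L)) (S : Subring L)
    (hK : ∀ a, algebraMap K L a ∈ S) (hyS : y ∈ S) (t : L) : t ∈ S := by
  obtain ⟨a, rfl⟩ := h.exists_sum_eq hy hm t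
  exact sum_mem fun i _ => mul_mem (hK _) (pow_mem hyS i)

/-- Generators of a Heisenberg extension `L / K`: `x` and `y` are Artin–Schreier elements with
constants `β`, `α`, and `z` is an Artin–Schreier element with constant `α x + γ`. -/
structure HeisenbergGenerators (p : ℕ) {K : Type uK} [Field K] {L : Type uL} [Field L] [Algebra K L]
    (x y z : L) (α β γ : K) : Prop where
  wp_x : wp p x = algebraMap K L β
  wp_y : wp p y = algebraMap K L α
  wp_z : wp p z = algebraMap K L α * x + algebraMap K L γ
  generate : ∀ S : Subring L, (∀ a, algebraMap K L a ∈ S) → x ∈ S → y ∈ S → z ∈ S → ∀ t, t ∈ S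

namespace HeisenbergGenerators

variable {p : ℕ} [Fact p.Prime] {K : Type uK} [Field K] {L : Type uL} [Field L]
  [Algebra K L] {x y z : L} {α β γ : K}

/-- A `K`-embedding of `L` changes `x` and `y` by elements `i`, `j` of the prime field, and `z` by
`i y` up to the prime field. -/
theorem exists_coords (h : HeisenbergGenerators p x y z α β γ) {Ω : Type*} [Field Ω] [CharP Ω p]
    [Algebra K Ω] [Algebra L Ω] [IsScalarTower K L Ω] (φ : L →ₐ[K] Ω) :
    ∃ i j k : ZMod p, φ x = algebraMap L Ω x + ZMod.castHom (dvd_refl p) Ω i ∧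
      φ y = algebraMap L Ω y + ZMod.castHom (dvd_refl p) Ω j ∧
      φ z = algebraMap L Ω z + ZMod.castHom (dvd_refl p) Ω i * algebraMap L Ω y +
        ZMod.castHom (dvd_refl p) Ω k := by
  obtain ⟨i, hi⟩ := exists_cast_of_wp_eq_zero p (u := φ x - algebraMap L Ω x) (by
    rw [wp_sub, ← map_wp, ← map_wp, h.wp_x, AlgHom.commutes, ← IsScalarTower.algebraMap_apply,
      sub_self])
  obtain ⟨j, hj⟩ := exists_cast_of_wp_eq_zero p (u := φ y - algebraMap L Ω y) (by
    rw [wp_sub, ← map_wp, ← map_wp, h.wp_y, AlgHom.commutes, ← IsScalarTower.algebraMap_apply,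
      sub_self])
  set c := ZMod.castHom (dvd_refl p) Ω i with hc
  have hcp : c ^ p = c := pow_of_wp_eq_zero p (wp_castHom p i)
  obtain ⟨k, hk⟩ := exists_cast_of_wp_eq_zero p
    (u := φ z - algebraMap L Ω z - c * algebraMap L Ω y) (by
    have h1 : wp p (c * algebraMap L Ω y) = c * wp p (algebraMap L Ω y) := by
      rw [wp, wp, mul_pow, hcp]; ring
    rw [wp_sub, wp_sub, h1, ← map_wp, ← map_wp, ← map_wp, h.wp_z, h.wp_y, map_add, map_add, map_mul,
      map_mul, AlgHom.commutes, AlgHom.commutes, ← IsScalarTower.algebraMap_apply,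
      ← IsScalarTower.algebraMap_apply, hi]
    ring)
  refine ⟨i, j, k, ?_, ?_, ?_⟩
  · rw [← hc, hi]; ring
  · rw [hj]; ring
  · rw [hk]; ring

theorem normal (h : HeisenbergGenerators p x y z α β γ) [CharP L p] [Algebra.IsAlgebraic K L] :
    Normal K L := by
  refine normal_of_forall_mem_range fun φ a => ?_
  have : CharP (AlgebraicClosure L) p :=
    charP_of_injective_algebraMap (algebraMap L (AlgebraicClosure L)).injective p
  obtain ⟨i, j, k, hx, hy, hz⟩ := h.exists_coords φ
  have hcast : ∀ c : ZMod p, algebraMap L (AlgebraicClosure L) (ZMod.castHom (dvd_refl p) L c) =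
      ZMod.castHom (dvd_refl p) (AlgebraicClosure L) c := by
    intro c
    rw [← RingHom.comp_apply]
    congr 1
    exact Subsingleton.elim _ _
  have key := h.generate ((algebraMap L (AlgebraicClosure L)).range.comap
    (φ : L →+* AlgebraicClosure L))
    (fun a => ⟨algebraMap K L a, by
      rw [← IsScalarTower.algebraMap_apply]; exact (φ.commutes a).symm⟩)
    ⟨x + ZMod.castHom (dvd_refl p) L i, by rw [map_add, hcast]; exact hx.symm⟩
    ⟨y + ZMod.castHom (dvd_refl p) L j, by rw [map_add, hcast]; exact hy.symm⟩
    ⟨z + ZMod.castHom (dvd_refl p) L i * y + ZMod.castHom (dvd_refl p) L k, by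
      rw [map_add, map_add, map_mul, hcast, hcast]; exact hz.symm⟩ a
  exact key

/-- The coordinates of an automorphism on the generators identify the Galois group with the
Heisenberg group. -/
theorem exists_mulEquiv (h : HeisenbergGenerators p x y z α β γ) [CharP L p] [FiniteDimensional K L]
    [IsGalois K L] (hdeg : Module.finrank K L = p ^ 3) :
    ∃ e : (L ≃ₐ[K] L) ≃* Heisenberg p, ∀ σ : L ≃ₐ[K] L,
      σ x = x + ZMod.castHom (dvd_refl p) L (e σ).y ∧
      σ y = y + ZMod.castHom (dvd_refl p) L (e σ).x ∧
      σ z = z + ZMod.castHom (dvd_refl p) L (e σ).y * y + ZMod.castHom (dvd_refl p) L (e σ).z := by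
  have hp : p.Prime := Fact.out
  have H : ∀ σ : L ≃ₐ[K] L, ∃ g : Heisenberg p,
      σ x = x + ZMod.castHom (dvd_refl p) L g.y ∧ σ y = y + ZMod.castHom (dvd_refl p) L g.x ∧
      σ z = z + ZMod.castHom (dvd_refl p) L g.y * y + ZMod.castHom (dvd_refl p) L g.z := by
    intro σ
    obtain ⟨i, j, k, hx, hy, hz⟩ := h.exists_coords (σ : L →ₐ[K] L)
    exact ⟨⟨j, i, k⟩, hx, hy, hz⟩
  choose f hf using H
  have hinj : Function.Injective (ZMod.castHom (dvd_refl p) L) := RingHom.injective _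
  have huniq : ∀ (σ : L ≃ₐ[K] L) (g : Heisenberg p),
      σ x = x + ZMod.castHom (dvd_refl p) L g.y → σ y = y + ZMod.castHom (dvd_refl p) L g.x →
      σ z = z + ZMod.castHom (dvd_refl p) L g.y * y + ZMod.castHom (dvd_refl p) L g.z →
      f σ = g := by
    intro σ g hx hy hz
    obtain ⟨hx', hy', hz'⟩ := hf σ
    have h1 := hinj (add_left_cancel (hx'.symm.trans hx))
    have h2 := hinj (add_left_cancel (hy'.symm.trans hy))
    rw [hz', h1] at hz
    exact Heisenberg.ext h2 h1 (hinj (add_left_cancel hz))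
  have hcast : ∀ (σ : L ≃ₐ[K] L) (c : ZMod p), σ (ZMod.castHom (dvd_refl p) L c) =
      ZMod.castHom (dvd_refl p) L c := by
    intro σ c
    rw [← RingHom.coe_coe σ, ← RingHom.comp_apply]
    congr 1
    exact Subsingleton.elim _ _
  have hmul : ∀ σ τ, f (σ * τ) = f σ * f τ := by
    intro σ τ
    obtain ⟨hx, hy, hz⟩ := hf σ
    obtain ⟨hx', hy', hz'⟩ := hf τ
    refine huniq _ _ ?_ ?_ ?_
    · rw [AlgEquiv.mul_apply, hx', map_add, hcast, hx, Heisenberg.mul_def, map_add]; ring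
    · rw [AlgEquiv.mul_apply, hy', map_add, hcast, hy, Heisenberg.mul_def, map_add]; ring
    · rw [AlgEquiv.mul_apply, hz', map_add, map_add, map_mul, hcast, hcast, hz, hy,
        Heisenberg.mul_def]
      simp only [map_add, map_mul]
      ring
  have hfinj : Function.Injective f := by
    intro σ τ hστ
    ext t
    obtain ⟨hx, hy, hz⟩ := hf σ
    obtain ⟨hx', hy', hz'⟩ := hf τ
    rw [hστ] at hx hy hz
    exact h.generate (RingHom.eqLocus (σ : L →+* L) (τ : L →+* L))
      (fun a => (σ.commutes a).trans (τ.commutes a).symm) (hx.trans hx'.symm) (hy.trans hy'.symm)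
      (hz.trans hz'.symm) t
  let E : Heisenberg p ≃ ZMod p × ZMod p × ZMod p :=
    ⟨fun g => (g.x, g.y, g.z), fun t => ⟨t.1, t.2.1, t.2.2⟩, fun _ => rfl, fun _ => rfl⟩
  have hcard : Nat.card (Heisenberg p) = p ^ 3 := by
    rw [Nat.card_congr E, Nat.card_prod, Nat.card_prod, Nat.card_zmod]
    ring
  have : Finite (Heisenberg p) := Finite.of_equiv _ E.symm
  have hbij : Function.Bijective f := hfinj.bijective_of_nat_card_le (by
    rw [hcard, IsGalois.card_aut_eq_finrank, hdeg])
  exact ⟨MulEquiv.ofBijective (MonoidHom.mk' f hmul) hbij, hf⟩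

end HeisenbergGenerators

end Galois

/-! ### Ramification breaks -/

section Normalized

variable {K : Type uK} [Field K] {v : Valuation K ℤᵐ⁰} {L : Type uL} [Field L] [Algebra K L]
  {w : Valuation L ℤᵐ⁰}

theorem val_uniformizer (hw : Function.Surjective w) : w (uniformizer w) = exp (-1) := by
  unfold uniformizer
  exact Classical.epsilon_spec (p := fun π : L => w π = exp (-1 : ℤ)) (hw _)

theorem isNormalizedExtension_normalizedValuation
    (h : ∃ w : Valuation L ℤᵐ⁰, IsNormalizedExtension v w) :
    IsNormalizedExtension v (normalizedValuation v L) := by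
  unfold normalizedValuation
  rw [dif_pos h]
  exact h.choose_spec

namespace TotallyRamified

theorem isNormalizedExtension (h : TotallyRamified v w) : IsNormalizedExtension v w :=
  ⟨h.surjective, h.isEquiv⟩

theorem normalizedValuation_eq (hv : Function.Surjective v) (h : TotallyRamified v w) :
    normalizedValuation v L = w := by
  have hn := isNormalizedExtension_normalizedValuation ⟨w, h.isNormalizedExtension⟩
  exact h.eq_of_isEquiv hv hn.1 hn.2

theorem isTotallyRamifiedExtension (hv : Function.Surjective v) (h : TotallyRamified v w) :
    IsTotallyRamifiedExtension v L := by
  refine ⟨h.finiteDimensional, ?_⟩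
  rw [ramificationIndex, h.normalizedValuation_eq hv, h.map_algebraMap, val_uniformizer hv,
    exp_pow_eq, log_exp]
  ring

theorem ramificationNumber_eq (hv : Function.Surjective v) (h : TotallyRamified v w)
    {σ : L ≃ₐ[K] L} {c : ℕ} (hσ : ∀ π, w π = exp (-1) → w (σ π - π) = exp (-1 - c : ℤ)) :
    ramificationNumber v L σ = ((c : ℤ) : WithTop ℤ) := by
  have h1 := hσ _ (val_uniformizer h.surjective)
  rw [ramificationNumber, h.normalizedValuation_eq hv, addOrd, if_neg (ne_zero_of_eq_exp h1), h1,
    log_exp, ← WithTop.coe_add]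
  congr 1
  ring

end TotallyRamified

theorem ramificationNumber_one : ramificationNumber v L 1 = ⊤ := by
  rw [ramificationNumber, AlgEquiv.one_apply, sub_self, addOrd, if_pos rfl, WithTop.top_add]

end Normalized

section Heisenberg

variable {p : ℕ}

/-- The break of an element of the Heisenberg group for the filtration
`H ⊃ {y = 0} ⊃ {y = x = 0} ⊃ 1` with breaks `l₁`, `l₂`, `l₃`. -/
noncomputable def heisenbergBreak (l₁ l₂ l₃ : ℕ) (g : Heisenberg p) : WithTop ℤ :=
  open Classical in
  if g.y ≠ 0 then ((l₁ : ℤ) : WithTop ℤ) else if g.x ≠ 0 then ((l₂ : ℤ) : WithTop ℤ)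
  else if g.z ≠ 0 then ((l₃ : ℤ) : WithTop ℤ) else ⊤

variable {l₁ l₂ l₃ : ℕ}

theorem le_heisenbergBreak_iff (h₁₂ : l₁ < l₂) (h₂₃ : l₂ < l₃) (n : ℕ) (g : Heisenberg p) :
    ((n : ℤ) : WithTop ℤ) ≤ heisenbergBreak l₁ l₂ l₃ g ↔
      (l₁ < n → g.y = 0) ∧ (l₂ < n → g.x = 0) ∧ (l₃ < n → g.z = 0) := by
  unfold heisenbergBreak
  split_ifs with hy hx hz
  · simp only [WithTop.coe_le_coe, Nat.cast_le, hy, imp_false, not_lt]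
    constructor
    · intro h; refine ⟨h, ?_, ?_⟩ <;> intro <;> omega
    · exact fun h => h.1
  · simp only [ne_eq, not_not] at hy
    simp only [WithTop.coe_le_coe, Nat.cast_le, hy, hx, imp_false, not_lt, implies_true, true_and]
    constructor
    · intro h; refine ⟨h, ?_⟩; intro; omega
    · exact fun h => h.1
  · simp only [ne_eq, not_not] at hy hx
    simp only [WithTop.coe_le_coe, Nat.cast_le, hy, hx, hz, imp_false, not_lt, implies_true,
      true_and]
  · simp only [ne_eq, not_not] at hy hx hz
    simp [hy, hx, hz]

variable [Fact p.Prime]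

/-- The orders of the groups of the filtration `H ⊃ {y = 0} ⊃ {y = x = 0} ⊃ 1`. -/
theorem card_heisenberg_filtration :
    Nat.card (Set.univ : Set (Heisenberg p)) = p ^ 3 ∧
    Nat.card {g : Heisenberg p | g.y = 0} = p ^ 2 ∧
    Nat.card {g : Heisenberg p | g.y = 0 ∧ g.x = 0} = p ∧
    Nat.card {g : Heisenberg p | g.y = 0 ∧ g.x = 0 ∧ g.z = 0} = 1 := by
  refine ⟨?_, ?_, ?_, ?_⟩
  · let E : (Set.univ : Set (Heisenberg p)) ≃ ZMod p × ZMod p × ZMod p :=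
      ⟨fun g => (g.1.x, g.1.y, g.1.z), fun t => ⟨⟨t.1, t.2.1, t.2.2⟩, trivial⟩, fun _ => rfl,
        fun _ => rfl⟩
    rw [Nat.card_congr E, Nat.card_prod, Nat.card_prod, Nat.card_zmod]
    ring
  · let E : {g : Heisenberg p | g.y = 0} ≃ ZMod p × ZMod p :=
      ⟨fun g => (g.1.x, g.1.z), fun t => ⟨⟨t.1, 0, t.2⟩, rfl⟩,
        fun g => Subtype.ext (Heisenberg.ext rfl g.2.symm rfl), fun _ => rfl⟩
    rw [Nat.card_congr E, Nat.card_prod, Nat.card_zmod]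
    ring
  · let E : {g : Heisenberg p | g.y = 0 ∧ g.x = 0} ≃ ZMod p :=
      ⟨fun g => g.1.z, fun t => ⟨⟨0, 0, t⟩, rfl, rfl⟩,
        fun g => Subtype.ext (Heisenberg.ext g.2.2.symm g.2.1.symm rfl), fun _ => rfl⟩
    rw [Nat.card_congr E, Nat.card_zmod]
  · have : {g : Heisenberg p | g.y = 0 ∧ g.x = 0 ∧ g.z = 0} = {⟨0, 0, 0⟩} := by
      ext g
      rw [Set.mem_singleton_iff, Heisenberg.ext_iff]
      simp only [Set.mem_ofPred_eq]
      tauto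
    rw [this]
    simp

variable {K : Type uK} [Field K] {v : Valuation K ℤᵐ⁰} {L : Type uL} [Field L] [Algebra K L]

/-- The upper breaks of a Heisenberg extension with three distinct lower breaks. -/
theorem upperBreaks_eq_of_heisenbergBreak [FiniteDimensional K L]
    (hdeg : Module.finrank K L = p ^ 3) (e : (L ≃ₐ[K] L) ≃* Heisenberg p) (h₁ : 0 < l₁)
    (h₁₂ : l₁ < l₂) (h₂₃ : l₂ < l₃)
    (he : ∀ σ, ramificationNumber v L σ = heisenbergBreak l₁ l₂ l₃ (e σ)) :
    upperBreaks v L p = {(l₁ : ℚ), l₁ + ((l₂ : ℚ) - l₁) / p,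
      l₁ + ((l₂ : ℚ) - l₁) / p + ((l₃ : ℚ) - l₂) / p ^ 2} := by
  have hp : p.Prime := Fact.out
  have hlow : lowerBreaks v L = {l₁, l₂, l₃} := by
    ext n
    simp only [lowerBreaks, Set.mem_ofPred_eq, he, Set.mem_insert_iff, Set.mem_singleton_iff]
    constructor
    · rintro ⟨σ, -, hσ⟩
      unfold heisenbergBreak at hσ
      split_ifs at hσ
      · left; exact_mod_cast hσ.symm
      · right; left; exact_mod_cast hσ.symm
      · right; right; exact_mod_cast hσ.symm
      · exact absurd hσ (WithTop.coe_ne_top).symm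
    · have hne : ∀ g : Heisenberg p, g ≠ 1 → e.symm g ≠ 1 := fun g hg h => hg (by
        rw [← e.apply_symm_apply g, h, map_one])
      rintro (rfl | rfl | rfl)
      · refine ⟨e.symm ⟨0, 1, 0⟩, hne _ fun h => ?_, ?_⟩
        · exact one_ne_zero (congrArg Heisenberg.y h)
        · simp [heisenbergBreak]
      · refine ⟨e.symm ⟨1, 0, 0⟩, hne _ fun h => ?_, ?_⟩
        · exact one_ne_zero (congrArg Heisenberg.x h)
        · simp [heisenbergBreak]
      · refine ⟨e.symm ⟨0, 0, 1⟩, hne _ fun h => ?_, ?_⟩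
        · exact one_ne_zero (congrArg Heisenberg.z h)
        · simp [heisenbergBreak]
  have hcard : ∀ n : ℕ, Nat.card (lowerRamificationGroup v L n) =
      Nat.card {g : Heisenberg p | (l₁ < n → g.y = 0) ∧ (l₂ < n → g.x = 0) ∧
        (l₃ < n → g.z = 0)} := by
    intro n
    refine Nat.card_congr (e.toEquiv.subtypeEquiv fun σ => ?_)
    change ((n : ℤ) : WithTop ℤ) ≤ ramificationNumber v L σ ↔ _
    rw [he]
    exact le_heisenbergBreak_iff h₁₂ h₂₃ n (e σ)
  obtain ⟨c₀, c₁, c₂, c₃⟩ := card_heisenberg_filtration (p := p)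
  have hp1 := hp.one_lt
  have g₁ : Nat.card (lowerRamificationGroup v L l₁) = p ^ 3 := by
    rw [hcard, ← c₀]
    simp [h₁₂.le, (h₁₂.trans h₂₃).le, not_lt.2]
  have g₁' : Nat.card (lowerRamificationGroup v L (l₁ + 1)) = p ^ 2 := by
    rw [hcard, ← c₁]
    simp [show ¬ l₂ < l₁ + 1 by omega, show ¬ l₃ < l₁ + 1 by omega]
  have g₂ : Nat.card (lowerRamificationGroup v L l₂) = p ^ 2 := by
    rw [hcard, ← c₁]
    simp [h₁₂, show ¬ l₃ < l₂ by omega]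
  have g₂' : Nat.card (lowerRamificationGroup v L (l₂ + 1)) = p := by
    rw [hcard]
    conv_rhs => rw [← c₂]
    simp [show l₁ < l₂ + 1 by omega, show ¬ l₃ < l₂ + 1 by omega]
  have g₃ : Nat.card (lowerRamificationGroup v L l₃) = p := by
    rw [hcard]
    conv_rhs => rw [← c₂]
    simp [h₂₃, h₁₂.trans h₂₃]
  have g₃' : Nat.card (lowerRamificationGroup v L (l₃ + 1)) = 1 := by
    rw [hcard]
    refine Eq.trans ?_ c₃
    simp [show l₁ < l₃ + 1 by omega, show l₂ < l₃ + 1 by omega]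
  have m₁ : lowerBreakMultiplicity v L p l₁ = 1 := by
    rw [lowerBreakMultiplicity, g₁, g₁', pow_succ, Nat.mul_div_cancel_left _ (by positivity)]
    simpa using Nat.log_pow hp1 1
  have m₂ : lowerBreakMultiplicity v L p l₂ = 1 := by
    rw [lowerBreakMultiplicity, g₂, g₂', pow_two, Nat.mul_div_cancel_left _ hp.pos]
    simpa using Nat.log_pow hp1 1
  have m₃ : lowerBreakMultiplicity v L p l₃ = 1 := by
    rw [lowerBreakMultiplicity, g₃, g₃', Nat.div_one]
    simpa using Nat.log_pow hp1 1
  have hfin : (lowerBreaks_finite v L).toFinset = {l₁, l₂, l₃} := by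
    ext n
    simp [hlow]
  have hpos : positiveLowerBreaks v L p = ((([l₁, l₂, l₃] : List ℕ)) : Multiset ℕ) := by
    have hfilter : ({l₁, l₂, l₃} : Finset ℕ).filter (0 < ·) = {l₁, l₂, l₃} := by
      rw [Finset.filter_eq_self]
      intro n hn
      simp only [Finset.mem_insert, Finset.mem_singleton] at hn
      omega
    rw [positiveLowerBreaks, hfin, hfilter, Finset.sum_insert, Finset.sum_insert,
      Finset.sum_singleton, m₁, m₂, m₃]
    · rfl
    · simp only [Finset.mem_singleton]; omega
    · simp only [Finset.mem_insert, Finset.mem_singleton]; omega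
  have hsort : (positiveLowerBreaks v L p).sort (· ≤ ·) = [l₁, l₂, l₃] := by
    rw [hpos, Multiset.coe_sort]
    refine List.mergeSort_eq_self _ ?_
    simp [h₁₂.le, h₂₃.le, (h₁₂.trans h₂₃).le]
  have h0 : 0 ∉ lowerBreaks v L := by
    rw [hlow]
    simp only [Set.mem_insert_iff, Set.mem_singleton_iff]
    omega
  rw [upperBreaks, if_neg h0, hsort, hdeg, padicValNat.prime_pow, Nat.div_self (pow_pos hp.pos 3)]
  simp only [upperBreaksAux, zero_add, sub_zero, Nat.cast_one, one_mul, pow_zero,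
    div_one, pow_one]
  rfl

end Heisenberg

/-! ### The lower breaks of a Heisenberg tower -/

section Tower

set_option linter.unusedSectionVars false

theorem val_map_sub_of_wp {p : ℕ} [Fact p.Prime] {L : Type uL} [Field L] [CharP L p]
    (w : Valuation L ℤᵐ⁰) (σ : L →+* L) {Y : L} {m : ℤ} (hm : 0 < m)
    (h : w (σ (wp p Y) - wp p Y) = exp (p * m)) : w (σ Y - Y) = exp m := by
  refine val_eq_of_val_wp (p := p) w hm ?_
  rw [wp_sub, ← map_wp, h]

theorem val_castHom_eq_one {p : ℕ} [Fact p.Prime] {L : Type uL} [Field L] [CharP L p]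
    (w : Valuation L ℤᵐ⁰) {i : ZMod p} (hi : i ≠ 0) : w (ZMod.castHom (dvd_refl p) L i) = 1 :=
  val_eq_one_of_wp_eq_zero (p := p) w (wp_castHom p i) ((map_ne_zero _).2 hi)

theorem TotallyRamified.val_eq_of_wp {p : ℕ} [Fact p.Prime] {N : Type uK} [Field N] {M : Type uL}
    [Field M] [Algebra N M] {u : Valuation N ℤᵐ⁰} {w : Valuation M ℤᵐ⁰} (h : TotallyRamified u w)
    (hdeg : Module.finrank N M = p) {y : M} {D : N} {l : ℕ} (hl : 0 < l) (hy : w y = exp (l : ℤ))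
    (hD : wp p y = algebraMap N M D) : u D = exp (l : ℤ) := by
  refine eq_exp_of_pow_eq (Fact.out : p.Prime).ne_zero (n := p) ?_
  rw [← hdeg, ← h.map_algebraMap, ← hD, val_wp_of_one_lt w, hy, exp_pow_eq, hdeg]
  rw [hy, ← exp_zero, exp_lt_exp]
  exact_mod_cast hl

/-- Coprimality to a power of `p`, in the form required of values of generators. -/
theorem isCoprime_pow_of_not_dvd {p : ℕ} [Fact p.Prime] {l : ℕ} (hl : ¬ p ∣ l) (k : ℕ) :
    IsCoprime (l : ℤ) ((p ^ k : ℕ) : ℤ) := by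
  rw [Nat.isCoprime_iff_coprime]
  exact (((Fact.out : p.Prime).coprime_iff_not_dvd.2 hl).pow_left k).symm

variable {p : ℕ} [Fact p.Prime]
  {K : Type uK} [Field K] {F M L : Type uL} [Field F] [Field M] [Field L]
  [Algebra K F] [Algebra K M] [Algebra K L] [Algebra F M] [Algebra F L] [Algebra M L]
  [IsScalarTower K F M] [IsScalarTower K F L] [IsScalarTower K M L] [IsScalarTower F M L]
  {v : Valuation K ℤᵐ⁰} {wF : Valuation F ℤᵐ⁰} {wM : Valuation M ℤᵐ⁰} {w : Valuation L ℤᵐ⁰}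

/-- A tower of three totally ramified Artin–Schreier steps `K ⊂ F ⊂ M ⊂ L`. The generators `x`,
`y - f`, `z - h` have poles of orders `b₁ < b₂ < b₃` prime to `p`, where `f` and `h` lie in the
preceding field, while `x`, `y`, `z` satisfy the equations of a Heisenberg extension of `K`. -/
structure HeisenbergTower (p : ℕ) (v : Valuation K ℤᵐ⁰) (wF : Valuation F ℤᵐ⁰)
    (wM : Valuation M ℤᵐ⁰) (w : Valuation L ℤᵐ⁰) (x : F) (y : M) (z : L) (f : F) (h : M)
    (α β γ : K) (b₁ b₂ b₃ : ℕ) : Prop where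
  ramF : TotallyRamified v wF
  ramM : TotallyRamified wF wM
  ramL : TotallyRamified wM w
  degF : Module.finrank K F = p
  degM : Module.finrank F M = p
  degL : Module.finrank M L = p
  wp_x : wp p x = algebraMap K F β
  wp_y : wp p y = algebraMap K M α
  wp_z : wp p z = algebraMap K L α * algebraMap F L x + algebraMap K L γ
  val_x : wF x = exp (b₁ : ℤ)
  val_y : wM (y - algebraMap F M f) = exp (b₂ : ℤ)
  val_z : w (z - algebraMap M L h) = exp (b₃ : ℤ)
  not_dvd₁ : ¬ p ∣ b₁
  not_dvd₂ : ¬ p ∣ b₂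
  not_dvd₃ : ¬ p ∣ b₃
  pos : 0 < b₁
  lt₁₂ : b₁ < b₂
  lt₂₃ : b₂ < b₃

namespace HeisenbergTower

variable {x : F} {y : M} {z : L} {f : F} {h : M} {α β γ : K} {b₁ b₂ b₃ : ℕ}
  (T : HeisenbergTower p v wF wM w x y z f h α β γ b₁ b₂ b₃)

include T

theorem finrank_KM : Module.finrank K M = p ^ 2 := by
  rw [← Module.finrank_mul_finrank K F M, T.degF, T.degM, pow_two]

theorem finrank_KL : Module.finrank K L = p ^ 3 := by
  rw [← Module.finrank_mul_finrank K M L, T.finrank_KM, T.degL, pow_succ p 2]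

theorem mem_of_F (S : Subring L) (hK : ∀ a, algebraMap K L a ∈ S) (hx : algebraMap F L x ∈ S)
    (t : F) : algebraMap F L t ∈ S :=
  T.ramF.mem_subring (m := b₁) T.val_x
    (by rw [T.degF]; simpa using isCoprime_pow_of_not_dvd T.not_dvd₁ 1) (S.comap (algebraMap F L))
    (fun a => by
      rw [Subring.mem_comap, ← IsScalarTower.algebraMap_apply]; exact hK a) hx t

theorem mem_of_M (S : Subring L) (hF : ∀ a, algebraMap F L a ∈ S) (hy : algebraMap M L y ∈ S)
    (t : M) : algebraMap M L t ∈ S :=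
  T.ramM.mem_subring (m := b₂) T.val_y
    (by rw [T.degM]; simpa using isCoprime_pow_of_not_dvd T.not_dvd₂ 1) (S.comap (algebraMap M L))
    (fun a => by
      rw [Subring.mem_comap, ← IsScalarTower.algebraMap_apply]; exact hF a)
    (by
      rw [Subring.mem_comap, map_sub, ← IsScalarTower.algebraMap_apply]
      exact sub_mem hy (hF f)) t

theorem mem_of_L (S : Subring L) (hM : ∀ a, algebraMap M L a ∈ S) (hz : z ∈ S) (t : L) : t ∈ S :=
  T.ramL.mem_subring (m := b₃) T.val_z
    (by rw [T.degL]; simpa using isCoprime_pow_of_not_dvd T.not_dvd₃ 1) S hM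
    (sub_mem hz (hM h)) t

theorem generators :
    HeisenbergGenerators p (algebraMap F L x) (algebraMap M L y) z α β γ where
  wp_x := by rw [← map_wp, T.wp_x, ← IsScalarTower.algebraMap_apply]
  wp_y := by rw [← map_wp, T.wp_y, ← IsScalarTower.algebraMap_apply]
  wp_z := T.wp_z
  generate S hK hx hy hz := T.mem_of_L S (T.mem_of_M S (T.mem_of_F S hK hx) hy) hz

theorem ramKM : TotallyRamified v wM := T.ramF.trans T.ramM

theorem ramKL : TotallyRamified v w := T.ramKM.trans T.ramL

theorem map_M (a : M) : w (algebraMap M L a) = wM a ^ p := by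
  rw [T.ramL.map_algebraMap, T.degL]

theorem map_F (a : F) : w (algebraMap F L a) = wF a ^ (p ^ 2) := by
  rw [IsScalarTower.algebraMap_apply F M L, T.map_M, T.ramM.map_algebraMap, T.degM, ← pow_mul,
    pow_two]

variable [CharP L p]

/-- An automorphism that displaces `z - h` by the relative amount `c` has ramification number
`c`. -/
theorem val_of_val_z (σ : L ≃ₐ[K] L) {c : ℤ} (hc : 0 < c)
    (hσ : w (σ (z - algebraMap M L h) - (z - algebraMap M L h)) = exp (b₃ - c)) (π : L)
    (hπ : w π = exp (-1)) : w (σ π - π) = exp (-1 - c) := by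
  have hp : p.Prime := Fact.out
  have := val_map_sub_algebraMap (w := w) (p := p) (M := L) (L := L) T.ramKL three_pos T.finrank_KL
    one_pos (fun a => by simp) (σ : L →ₐ[K] L) hc T.val_z (by exact_mod_cast T.not_dvd₃)
    (by simpa using hσ) hπ (by
      rw [dvd_neg, ← Nat.cast_one, Int.natCast_dvd_natCast, Nat.dvd_one]
      exact hp.ne_one)
  simpa using this

/-- If an automorphism displaces `y - f` by the relative amount `c < b₃`, then so it does `z - h`:
the constant `(z - h) ^ p - (z - h)` lies in `M` and has value prime to `p`. -/
theorem val_of_val_y (σ : L ≃ₐ[K] L) {c : ℤ} (hc : 0 < c) (hc3 : c < b₃)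
    (hσ : w (σ (algebraMap M L (y - algebraMap F M f)) - algebraMap M L (y - algebraMap F M f)) =
      exp (p * (b₂ - c))) (π : L) (hπ : w π = exp (-1)) : w (σ π - π) = exp (-1 - c) := by
  have hp : p.Prime := Fact.out
  set X := algebraMap F M x with hX
  set D : M := algebraMap K M α * X + algebraMap K M γ - wp p h with hD
  have hwp : wp p (z - algebraMap M L h) = algebraMap M L D := by
    rw [wp_sub, T.wp_z, hD, hX, map_sub, map_add, map_mul, ← map_wp,
      ← IsScalarTower.algebraMap_apply, ← IsScalarTower.algebraMap_apply,
      ← IsScalarTower.algebraMap_apply]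
  have hvD : wM D = exp (b₃ : ℤ) :=
    T.ramL.val_eq_of_wp T.degL (T.pos.trans (T.lt₁₂.trans T.lt₂₃)) T.val_z hwp
  refine T.val_of_val_z σ hc (val_map_sub_of_wp (p := p) w (σ : L →+* L) (by omega) ?_) π hπ
  rw [hwp]
  exact val_map_sub_algebraMap (w := w) (p := p) T.ramKM two_pos T.finrank_KM hp.pos T.map_M
    ((σ : L →ₐ[K] L).comp (IsScalarTower.toAlgHom K M L)) hc T.val_y
    (by exact_mod_cast T.not_dvd₂) hσ hvD (by exact_mod_cast T.not_dvd₃)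

/-- An automorphism that moves `x` has ramification number `b₁`: the displacement of `x` determines
that of the constant `(y - f) ^ p - (y - f)` in `F`, hence that of `y - f`. -/
theorem val_of_val_x (σ : L ≃ₐ[K] L)
    (hσ : w (σ (algebraMap F L x) - algebraMap F L x) = 1) (π : L) (hπ : w π = exp (-1)) :
    w (σ π - π) = exp (-1 - b₁ : ℤ) := by
  have hp : p.Prime := Fact.out
  have h₁₂ := T.lt₁₂
  have h₂₃ := T.lt₂₃
  have h₁ := T.pos
  have hCM : CharP M p := RingHom.charP (algebraMap M L) (algebraMap M L).injective p
  set A : F := algebraMap K F α - wp p f with hA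
  have hwp : wp p (y - algebraMap F M f) = algebraMap F M A := by
    rw [wp_sub, T.wp_y, hA, map_sub, ← map_wp, ← IsScalarTower.algebraMap_apply]
  have hvA : wF A = exp (b₂ : ℤ) := T.ramM.val_eq_of_wp T.degM (by omega) T.val_y hwp
  refine T.val_of_val_y σ (by omega) (by omega)
    (val_map_sub_of_wp (p := p) w (σ : L →+* L) ?_ ?_) π hπ
  · exact mul_pos (by exact_mod_cast hp.pos) (by omega)
  rw [← map_wp, hwp, ← IsScalarTower.algebraMap_apply, ← mul_assoc, ← pow_two, ← Nat.cast_pow]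
  exact val_map_sub_algebraMap (w := w) (p := p) (c := b₁) T.ramF one_pos
    (by rw [T.degF, pow_one]) (pow_pos hp.pos 2) T.map_F
    ((σ : L →ₐ[K] L).comp (IsScalarTower.toAlgHom K F L)) (by omega) T.val_x
    (by exact_mod_cast T.not_dvd₁) (by simpa using hσ) hvA (by exact_mod_cast T.not_dvd₂)

/-- The Galois group and the upper breaks of the tower. -/
theorem isGalois_and_upperBreaks [FiniteDimensional K L] [Algebra.IsSeparable K L]
    (hv : Function.Surjective v) :
    IsGalois K L ∧ Nonempty ((L ≃ₐ[K] L) ≃* Heisenberg p) ∧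
      upperBreaks v L p = {(b₁ : ℚ), b₁ + ((b₂ : ℚ) - b₁) / p,
        b₁ + ((b₂ : ℚ) - b₁) / p + ((b₃ : ℚ) - b₂) / p ^ 2} := by
  have hp : p.Prime := Fact.out
  have G := T.generators
  have : Normal K L := G.normal
  have hgal : IsGalois K L := {}
  obtain ⟨e, he⟩ := G.exists_mulEquiv T.finrank_KL
  refine ⟨hgal, ⟨e⟩, upperBreaks_eq_of_heisenbergBreak T.finrank_KL e T.pos T.lt₁₂ T.lt₂₃ ?_⟩
  intro σ
  obtain ⟨hx, hy, hz⟩ := he σ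
  have h₁₂ := T.lt₁₂
  have h₂₃ := T.lt₂₃
  have h₁ := T.pos
  unfold heisenbergBreak
  split_ifs with h1 h2 h3
  · refine T.ramKL.ramificationNumber_eq hv (T.val_of_val_x σ ?_)
    rw [hx, add_sub_cancel_left]
    exact val_castHom_eq_one w h1
  · simp only [ne_eq, not_not] at h1
    rw [h1, map_zero, add_zero] at hx
    have hfixF : ∀ t, σ (algebraMap F L t) = algebraMap F L t :=
      T.mem_of_F (RingHom.eqLocus (σ : L →+* L) (RingHom.id L)) (fun a => σ.commutes a) hx
    refine T.ramKL.ramificationNumber_eq hv (T.val_of_val_y σ (by omega) (by omega) ?_)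
    rw [map_sub (algebraMap M L), map_sub σ, hy, ← IsScalarTower.algebraMap_apply, hfixF,
      sub_sub_sub_cancel_right, add_sub_cancel_left, sub_self, mul_zero, exp_zero]
    exact val_castHom_eq_one w h2
  · simp only [ne_eq, not_not] at h1 h2
    rw [h1, map_zero, add_zero] at hx
    rw [h2, map_zero, add_zero] at hy
    have hfixF : ∀ t, σ (algebraMap F L t) = algebraMap F L t :=
      T.mem_of_F (RingHom.eqLocus (σ : L →+* L) (RingHom.id L)) (fun a => σ.commutes a) hx
    have hfixM : ∀ t, σ (algebraMap M L t) = algebraMap M L t :=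
      T.mem_of_M (RingHom.eqLocus (σ : L →+* L) (RingHom.id L)) hfixF hy
    refine T.ramKL.ramificationNumber_eq hv (T.val_of_val_z σ (by omega) ?_)
    rw [map_sub σ, hz, hfixM, h1, map_zero, zero_mul, add_zero, sub_sub_sub_cancel_right,
      add_sub_cancel_left, sub_self, exp_zero]
    exact val_castHom_eq_one w h3
  · simp only [ne_eq, not_not] at h1 h2 h3
    have : σ = 1 := by
      rw [← e.map_eq_one_iff]
      exact Heisenberg.ext h2 h1 h3
    rw [this, ramificationNumber_one]

end HeisenbergTower

end Tower

/-! ### Construction of the Heisenberg extension -/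

section Construction

/-- The exponents of `α = ω ^ p β ^ s`: the congruence conditions on `a` make both `s` and `s + 1`
prime to `p`. -/
theorem exists_exponents {p : ℕ} [Fact p.Prime] {a : ℤ} {b : ℕ} (hb : ¬ p ∣ b)
    (ha0 : ¬ a ≡ 0 [ZMOD (p : ℤ)]) (hab : ¬ a ≡ -(b : ℤ) [ZMOD (p : ℤ)]) :
    ∃ (s : ℕ) (k : ℤ), ¬ p ∣ s ∧ ¬ p ∣ s + 1 ∧ p * k + s * b = a := by
  have hp : p.Prime := Fact.out
  have hp0 : (0 : ℤ) < p := by exact_mod_cast hp.pos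
  obtain ⟨u, t, hut⟩ := isCoprime_pow_of_not_dvd hb 1
  rw [pow_one] at hut
  obtain ⟨s, hs⟩ : ∃ s : ℕ, (s : ℤ) = (u * a) % p :=
    ⟨((u * a) % p).toNat, Int.toNat_of_nonneg (Int.emod_nonneg _ hp0.ne')⟩
  have hk : (p : ℤ) * (t * a + (u * a / p) * b) + s * b = a := by
    rw [hs]
    linear_combination a * hut + b * Int.emod_add_mul_ediv (u * a) p
  refine ⟨s, _, fun h => ha0 ?_, fun h => hab ?_, hk⟩
  · rw [Int.modEq_zero_iff_dvd, ← hk]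
    exact dvd_add (dvd_mul_right _ _) (Dvd.dvd.mul_right (Int.natCast_dvd_natCast.2 h) _)
  · rw [Int.modEq_iff_dvd, ← dvd_neg]
    have h1 : -(-(b : ℤ) - a) = p * (t * a + (u * a / p) * b) + ((s + 1 : ℕ) : ℤ) * b := by
      push_cast
      linear_combination -hk
    rw [h1]
    exact dvd_add (dvd_mul_right _ _) (Dvd.dvd.mul_right (Int.natCast_dvd_natCast.2 h) _)

/-- The pole order of the constant of a cyclic extension of degree `p` is its ramification
break. -/
theorem mem_lowerBreaks_of_wp {p : ℕ} [Fact p.Prime] {K : Type uK} [Field K] {F : Type uL} [Field F]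
    [CharP F p] [Algebra K F] [IsGalois K F] {v : Valuation K ℤᵐ⁰} (hv : Function.Surjective v)
    {w : Valuation F ℤᵐ⁰} (h : TotallyRamified v w) (hdeg : Module.finrank K F = p) {x : F} {β : K}
    {d : ℕ} (hd0 : 0 < d) (hd : ¬ p ∣ d) (hwx : w x = exp (d : ℤ))
    (hx : wp p x = algebraMap K F β) : d ∈ lowerBreaks v F := by
  have hp : p.Prime := Fact.out
  have := h.finiteDimensional
  have hcard : 1 < Nat.card (F ≃ₐ[K] F) := by
    rw [IsGalois.card_aut_eq_finrank, hdeg]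
    exact hp.one_lt
  obtain ⟨σ, hσ⟩ : ∃ σ : F ≃ₐ[K] F, σ ≠ 1 := by
    have : Nontrivial (F ≃ₐ[K] F) := Finite.one_lt_card_iff_nontrivial.1 hcard
    exact exists_ne 1
  refine ⟨σ, hσ, h.ramificationNumber_eq hv fun π hπ => ?_⟩
  have hne : σ x - x ≠ 0 := by
    intro h0
    apply hσ
    ext t
    exact h.mem_subring hwx (by rw [hdeg]; simpa using isCoprime_pow_of_not_dvd hd 1)
      (RingHom.eqLocus (σ : F →+* F) (RingHom.id F)) (fun a => σ.commutes a) (sub_eq_zero.1 h0) t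
  have hval : w (σ x - x) = 1 := by
    refine val_eq_one_of_wp_eq_zero (p := p) w ?_ hne
    rw [wp_sub, ← map_wp, hx, AlgEquiv.commutes, sub_self]
  have key := val_map_sub_algebraMap (w := w) (p := p) (M := F) (L := F) (c := d) h one_pos
    (by rw [hdeg, pow_one]) one_pos (fun a => by simp) (σ : F →ₐ[K] F) (by exact_mod_cast hd0) hwx
    (by exact_mod_cast hd) (by simpa using hval) hπ (by
      rw [dvd_neg, ← Nat.cast_one, Int.natCast_dvd_natCast, Nat.dvd_one]
      exact hp.ne_one)
  simpa using key

/-- Inverse, in the prime field, of an integer prime to `p`. -/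
theorem exists_inv_natCast {p : ℕ} [Fact p.Prime] {K : Type uK} [Field K] [CharP K p] {n : ℕ}
    (hn : ¬ p ∣ n) : ∃ κ : K, κ ^ p = κ ∧ κ * n = 1 := by
  refine ⟨ZMod.castHom (dvd_refl p) K (n : ZMod p)⁻¹, pow_of_wp_eq_zero p (wp_castHom p _), ?_⟩
  rw [map_inv₀, map_natCast]
  exact inv_mul_cancel₀ (by rwa [Ne, CharP.cast_eq_zero_iff K p])

/-- Over a totally ramified extension `F = K(x)` of degree `p` and break `b` there is a Heisenberg
tower with the pole orders `b`, `p a - (p - 1) b` and `p a + b`. -/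
theorem exists_heisenbergTower {p : ℕ} [Fact p.Prime] (hp2 : 2 < p) {K : Type uK} [Field K]
    [CharP K p] {v : Valuation K ℤᵐ⁰} (hv : Function.Surjective v) (hperf : ResiduallyPerfect p v)
    {F : Type uL} [Field F] [Algebra K F] {wF : Valuation F ℤᵐ⁰} (hF : TotallyRamified v wF)
    (hdegF : Module.finrank K F = p) {x : F} {β : K} {b a : ℕ} (hb : ¬ p ∣ b)
    (hx : wp p x = algebraMap K F β) (hvx : wF x = exp (b : ℤ)) (hvβ : v β = exp (b : ℤ))
    (hab : b < a) (ha0 : ¬ (a : ℤ) ≡ 0 [ZMOD (p : ℤ)])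
    (hab' : ¬ (a : ℤ) ≡ -(b : ℤ) [ZMOD (p : ℤ)]) :
    ∃ (M L : Type uL) (_ : Field M) (_ : Field L) (_ : Algebra K M) (_ : Algebra K L)
      (_ : Algebra F M) (_ : Algebra F L) (_ : Algebra M L) (_ : IsScalarTower K F M)
      (_ : IsScalarTower K F L) (_ : IsScalarTower K M L) (_ : IsScalarTower F M L)
      (wM : Valuation M ℤᵐ⁰) (w : Valuation L ℤᵐ⁰) (y : M) (z : L) (f : F) (h : M) (α γ : K),
      Algebra.IsSeparable F L ∧
      HeisenbergTower p v wF wM w x y z f h α β γ b (p * (a - b) + b) (p * a + b) := by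
  have hp : p.Prime := Fact.out
  have hCF : CharP F p := charP_of_injective_algebraMap (algebraMap K F).injective p
  have hperfF := hperf.of_totallyRamified hF
  have hmapF : ∀ c, wF (algebraMap K F c) = v c ^ p := by
    intro c; rw [hF.map_algebraMap, hdegF]
  have hb0 : 0 < b := Nat.pos_of_ne_zero (by rintro rfl; exact hb (dvd_zero p))
  have hbz : ¬ (p : ℤ) ∣ b := by exact_mod_cast hb
  have hb0z : (0 : ℤ) < b := by exact_mod_cast hb0
  have habz : (b : ℤ) < a := by exact_mod_cast hab
  have hp2z : (2 : ℤ) < p := by exact_mod_cast hp2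
  obtain ⟨s, k, hs, hs1, hk⟩ := exists_exponents hb ha0 hab'
  obtain ⟨ω, hω⟩ := hv (exp k)
  obtain ⟨κ, hκ, hκs⟩ := exists_inv_natCast (K := K) hs1
  -- The constants `α` and `γ = α β / (s + 1)`.
  set α : K := ω ^ p * β ^ s with hα
  set γ : K := κ * (ω ^ p * β ^ (s + 1)) with hγ
  have hvα : v α = exp (a : ℤ) := by
    rw [hα, map_mul, map_pow, map_pow, hω, hvβ, exp_pow_eq, exp_pow_eq, ← exp_add, hk]
  set l₂ : ℕ := p * (a - b) + b with hl₂
  have hl₂z : (l₂ : ℤ) = p * a - (p - 1) * b := by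
    rw [hl₂]; push_cast [hab.le]; ring
  have hl₂b : ¬ p ∣ l₂ := by
    rw [hl₂, Nat.dvd_add_right (dvd_mul_right _ _)]; exact hb
  have hbl₂ : b < l₂ := by
    have : 0 < p * (a - b) := Nat.mul_pos hp.pos (by omega)
    omega
  have hl₂0 : (0 : ℤ) < l₂ := by exact_mod_cast hb0.trans hbl₂
  -- Reduction of `α` over `F`, and the field `M = F(y)`.
  obtain ⟨f, hf⟩ := exists_val_sub_wp_eq hv hperf hmapF hb0z hbz hvβ hx habz
    (by rwa [Int.modEq_zero_iff_dvd] at ha0) hvα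
  rw [← hl₂z] at hf
  obtain ⟨M, _, _, y, hy, _, _, hdegM⟩ := exists_artinSchreier_extension p (algebraMap K F α)
  have hCM : CharP M p := charP_of_injective_algebraMap (algebraMap F M).injective p
  obtain ⟨wM, hwM⟩ := exists_extension hF.surjective M
  have hy' : wp p (y - algebraMap F M f) = algebraMap F M (algebraMap K F α - wp p f) := by
    rw [wp_sub, hy, map_sub, map_wp]
  obtain ⟨hdegM, hM, hvy⟩ := totallyRamified_of_wp (p := p) hF.surjective hdegM hwM hl₂0
    (by exact_mod_cast hl₂b) hf hy'
  have hmapM : ∀ c, wM (algebraMap F M c) = wF c ^ p := by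
    intro c; rw [hM.map_algebraMap, hdegM]
  -- Reduction of `α x + γ`, first over `F` and then over `M`.
  set D : F := algebraMap K F α * x + algebraMap K F γ with hD
  set g₀ : F := algebraMap K F κ * algebraMap K F ω * x ^ (s + 1) with hg₀
  set d : ℤ := p * a - (p - 2) * b with hd
  have hD₁ : wF (D - wp p g₀) = exp d := by
    have h1 : D = algebraMap K F ω ^ p * wp p x ^ s * x +
        algebraMap K F κ * (algebraMap K F ω ^ p * wp p x ^ (s + 1)) := by
      rw [hD, hα, hγ, hx]; simp only [map_mul, map_pow]
    rw [h1, val_heisenberg_constant hp2 hb0z hvx (k := p * k) (by rw [hmapF, hω, exp_pow_eq]) hs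
      (by rw [← map_pow, hκ])
      (by
        have := congrArg (algebraMap K F) hκs
        simpa using this)]
    · congr 1
      linear_combination (p : ℤ) * hk
    · have h2 : (p - 1 : ℤ) * b < (p - 1) * a := by
        apply mul_lt_mul_of_pos_left habz; omega
      linarith [congrArg (fun t : ℤ => (p - 1) * t) hk]
  have hdp : ¬ (p : ℤ) ∣ d := by
    intro h1
    have h2 : (p : ℤ) ∣ 2 * b := by
      have h3 : (2 * b : ℤ) = d - p * (a - b) := by rw [hd]; ring
      rw [h3]
      exact dvd_sub h1 (dvd_mul_right _ _)
    rcases (Nat.prime_iff_prime_int.1 hp).dvd_or_dvd h2 with h3 | h3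
    · exact absurd (Int.le_of_dvd two_pos h3) (by omega)
    · exact hbz h3
  obtain ⟨g₁, hg₁⟩ := exists_val_sub_wp_eq hF.surjective hperfF hmapM hl₂0
    (by exact_mod_cast hl₂b) hf hy' (d := d) (by rw [hl₂z, hd]; linarith) hdp hD₁
  set l₃ : ℕ := p * a + b with hl₃
  have hl₃z : (p : ℤ) * d - (p - 1) * l₂ = l₃ := by
    rw [hl₂z, hd, hl₃]; push_cast; ring
  rw [hl₃z] at hg₁
  have hl₃b : ¬ p ∣ l₃ := by
    rw [hl₃, Nat.dvd_add_right (dvd_mul_right _ _)]; exact hb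
  -- The field `L = M(z)`.
  obtain ⟨L, _, _, z, hz, _, _, hdegL⟩ := exists_artinSchreier_extension p (algebraMap F M D)
  have hCL : CharP L p := charP_of_injective_algebraMap (algebraMap M L).injective p
  obtain ⟨w, hw⟩ := exists_extension hM.surjective L
  set h : M := algebraMap F M g₀ + g₁ with hh
  have hz' : wp p (z - algebraMap M L h) =
      algebraMap M L (algebraMap F M (D - wp p g₀) - wp p g₁) := by
    rw [wp_sub, hz, ← map_wp, hh, wp_add, ← map_wp]
    simp only [map_sub, map_add]
    ring
  have hl₃0 : (0 : ℤ) < l₃ := by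
    have : 0 < l₃ := by rw [hl₃]; omega
    exact_mod_cast this
  obtain ⟨hdegL, hL, hvz⟩ := totallyRamified_of_wp (p := p) hM.surjective hdegL hw hl₃0
    (by exact_mod_cast hl₃b) hg₁ hz'
  let _ : Algebra K M := ((algebraMap F M).comp (algebraMap K F)).toAlgebra
  let _ : Algebra F L := ((algebraMap M L).comp (algebraMap F M)).toAlgebra
  let _ : Algebra K L := ((algebraMap M L).comp (algebraMap K M)).toAlgebra
  have _ : IsScalarTower K F M := IsScalarTower.of_algebraMap_eq' rfl
  have _ : IsScalarTower F M L := IsScalarTower.of_algebraMap_eq' rfl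
  have _ : IsScalarTower K M L := IsScalarTower.of_algebraMap_eq' rfl
  have _ : IsScalarTower K F L := IsScalarTower.of_algebraMap_eq' rfl
  refine ⟨M, L, inferInstance, inferInstance, inferInstance, inferInstance, inferInstance,
    inferInstance, inferInstance, inferInstance, inferInstance, inferInstance, inferInstance,
    wM, w, y, z, f, h, α, γ, Algebra.IsSeparable.trans F M L, ?_⟩
  exact
    { ramF := hF
      ramM := hM
      ramL := hL
      degF := hdegF
      degM := hdegM
      degL := hdegL
      wp_x := hx
      wp_y := hy
      wp_z := by rw [hz, hD, map_add, map_add, map_mul, map_mul]; rfl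
      val_x := hvx
      val_y := hvy
      val_z := hvz
      not_dvd₁ := hb
      not_dvd₂ := hl₂b
      not_dvd₃ := hl₃b
      pos := hb0
      lt₁₂ := hbl₂
      lt₂₃ := by
        have h1 : p * (a - b) < p * a := Nat.mul_lt_mul_of_pos_left (by omega) hp.pos
        omega }

end Construction

end ArtinSchreier

open ArtinSchreier WithZero in
theorem proposition5p2
    (p : ℕ) [Fact p.Prime] (hp : 2 < p)
    (K : Type uK) [Field K] [CharP K p] [Valued K ℤᵐ⁰]
    (hK : Function.Surjective (Valued.v : Valuation K ℤᵐ⁰)) [CompleteSpace K]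
    [PerfectField (IsLocalRing.ResidueField (Valued.v : Valuation K ℤᵐ⁰).valuationSubring)]
    (F : Type uL) [Field F] [Algebra K F] [FiniteDimensional K F] [IsGalois K F]
    (hF : Nonempty ((F ≃ₐ[K] F) ≃* Multiplicative (ZMod p)))
    (hram : IsRamifiedExtension (Valued.v : Valuation K ℤᵐ⁰) F)
    (b : ℕ) (hb : lowerBreaks (Valued.v : Valuation K ℤᵐ⁰) F = {b})
    (a : ℤ) (hab : (b : ℤ) < a)
    (ha0 : ¬ a ≡ 0 [ZMOD (p : ℤ)]) (hab' : ¬ a ≡ -(b : ℤ) [ZMOD (p : ℤ)]) :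
    ∃ (L : Type uL) (_ : Field L) (_ : Algebra K L) (_ : Algebra F L) (_ : IsScalarTower K F L)
      (_ : FiniteDimensional K L),
      IsTotallyRamifiedExtension
        (normalizedValuation (Valued.v : Valuation K ℤᵐ⁰) F) L ∧
      IsTotallyRamifiedExtension (Valued.v : Valuation K ℤᵐ⁰) L ∧
      IsGalois K L ∧
      Nonempty ((L ≃ₐ[K] L) ≃* Heisenberg p) ∧
      upperBreaks (Valued.v : Valuation K ℤᵐ⁰) L p =
        {(b : ℚ), (a : ℚ), (a : ℚ) + (b : ℚ) / (p : ℚ)} ∧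
      ∃ u ∈ upperBreaks (Valued.v : Valuation K ℤᵐ⁰) L p, ∀ n : ℤ, u ≠ (n : ℚ) := by
  have hpp : p.Prime := Fact.out
  have hp0 : (p : ℚ) ≠ 0 := by exact_mod_cast hpp.ne_zero
  set v : Valuation K ℤᵐ⁰ := Valued.v with hv
  have hperf : ResiduallyPerfect p v := residuallyPerfect_of_perfectField v
  have hCF : CharP F p := charP_of_injective_algebraMap (algebraMap K F).injective p
  -- Without an extension of `v`, the ramification index would be the junk value `0`.
  have hex : ∃ w : Valuation F ℤᵐ⁰, IsNormalizedExtension v w := by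
    classical
    by_contra hno
    rw [IsRamifiedExtension, ramificationIndex, normalizedValuation, dif_neg hno,
      Valuation.one_apply_of_ne_zero (by simpa using ne_zero_of_eq_exp (val_uniformizer hK)),
      log_one] at hram
    omega
  have hwF := isNormalizedExtension_normalizedValuation hex
  set wF := normalizedValuation v F with hwFdef
  obtain ⟨hdegF, x, β, d, hx, hd0, hd, hvβ⟩ := exists_ramified_generator hK hperf hF hwF (by
    intro π hπ h1
    obtain ⟨e, -, he⟩ := exists_exponent hK hwF.2
    rw [IsRamifiedExtension, ramificationIndex, ← hwFdef, he, val_uniformizer hK, ← hπ, ← he, h1,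
      log_exp] at hram
    omega)
  have hd0z : (0 : ℤ) < d := by exact_mod_cast hd0
  obtain ⟨-, hramF, hvx⟩ := totallyRamified_of_wp (p := p) hK hdegF.le hwF hd0z
    (by exact_mod_cast hd) hvβ hx
  have hdb : d = b := by
    have h1 := mem_lowerBreaks_of_wp hK hramF hdegF hd0 hd hvx hx
    rw [hb] at h1
    exact h1
  subst hdb
  obtain ⟨a, rfl⟩ := Int.eq_ofNat_of_zero_le (show 0 ≤ a by omega)
  have habn : d < a := by exact_mod_cast hab
  obtain ⟨M, L, _, _, _, _, _, _, _, _, _, _, _, wM, w, y, z, f, h, α, γ, _, T⟩ :=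
    exists_heisenbergTower hp hK hperf hramF hdegF hd hx hvx hvβ habn ha0 hab'
  have hCL : CharP L p := charP_of_injective_algebraMap (algebraMap F L).injective p
  have _ : FiniteDimensional K L := T.ramKL.finiteDimensional
  have _ : Algebra.IsSeparable K L := Algebra.IsSeparable.trans K F L
  obtain ⟨hgal, hiso, hU⟩ := T.isGalois_and_upperBreaks hK
  have hU' : upperBreaks v L p = {(d : ℚ), (a : ℚ), (a : ℚ) + (d : ℚ) / (p : ℚ)} := by
    have h2 : (d : ℚ) + (((p * (a - d) + d : ℕ) : ℚ) - d) / p = a := by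
      push_cast [habn.le]
      field_simp
      ring
    rw [hU, h2]
    congr 3
    push_cast [habn.le]
    field_simp
    ring
  refine ⟨L, inferInstance, inferInstance, inferInstance, inferInstance, inferInstance,
    (T.ramM.trans T.ramL).isTotallyRamifiedExtension hramF.surjective,
    T.ramKL.isTotallyRamifiedExtension hK, hgal, hiso, by simpa using hU', ?_⟩
  refine ⟨(a : ℚ) + (d : ℚ) / (p : ℚ), by rw [hU']; simp, fun n hn => hd ?_⟩
  have h3 : (d : ℚ) = p * (n - a) := by
    field_simp at hn
    linarith
  have h4 : (d : ℤ) = p * (n - a) := by exact_mod_cast h3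
  exact Int.natCast_dvd_natCast.1 ⟨_, h4⟩
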